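/- There is an absolute constant $c>0$ such that the following holds for all integers $n$ and $2\le\alpha\le\beta$ and every real $\delta>0$ (which may depend on $n,\alpha,\beta$) with $$\alpha\beta<\frac{n^{1-\delta}}{\log n}$$ (natural logarithm). Let $\mathcal T^-_\alpha$ be the Erdős–Rényi random graph $\mathcal G_{n,p}$ on $n$ labelled vertices with edge probability $p=n^{-2/(\alpha-1)}$, and let $\mathcal T^+_\beta$ be a uniformly random isolated $\beta$-clique on $n$ vertices, that is, the graph whose edges are all the pairs of distinct elements of a uniformly random $\beta$-element set of vertices. Let $C$ be a monotone Boolean circuit ($\wedge$- and $\vee$-gates of fan-in two, arbitrary fan-out, no negations) whose inputs are the $\binom n2$ indicator variables of the edges of a graph on $n$ vertices. If $C$ rejects $G\sim\mathcal T^-_\alpha$ with probability at least $2/3$ and accepts $G\sim\mathcal T^+_\beta$ with probability at least $2/3$, then the size of $C$, i.e. its number of gates, is at least $n^{c\,\delta^2\alpha}$. -/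

import Mathlib

open MeasureTheory ProbabilityTheory

/-- The gates of a monotone Boolean circuit on input variables indexed by `ι`, listed in a
topological order of the underlying directed acyclic graph: `Gates ι s` describes `s` gates.
Every gate is an `∧`-gate or an `∨`-gate with two incoming wires; each wire comes from an input
node (`Sum.inl i`) or from an earlier gate (`Sum.inr k`).  Fan-out is unrestricted. -/
inductive Gates (ι : Type) : ℕ → Type
  | nil : Gates ι 0
  | and {s : ℕ} (P : Gates ι s) (u v : ι ⊕ Fin s) : Gates ι (s + 1)
  | or {s : ℕ} (P : Gates ι s) (u v : ι ⊕ Fin s) : Gates ι (s + 1)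

/-- The Boolean value of a node (an input node or a gate) on the assignment `x`. -/
def Gates.value {ι : Type} : {s : ℕ} → Gates ι s → (ι → Bool) → ι ⊕ Fin s → Bool
  | _, _, x, Sum.inl i => x i
  | _, .nil, _, Sum.inr k => k.elim0
  | _, .and P u v, x, Sum.inr k =>
      Fin.lastCases (motive := fun _ => Bool) (P.value x u && P.value x v)
        (fun j => P.value x (Sum.inr j)) k
  | _, .or P u v, x, Sum.inr k =>
      Fin.lastCases (motive := fun _ => Bool) (P.value x u || P.value x v)
        (fun j => P.value x (Sum.inr j)) k

/-- A monotone circuit (fan-in two, gates `∧` and `∨`, no negations) with input variables indexed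
by `ι`.  Its `size` is the number of its gates; the input nodes are not counted. -/
structure MonotoneCircuit (ι : Type) where
  size : ℕ
  gates : Gates ι size
  output : ι ⊕ Fin size

/-- The Boolean function computed by a monotone circuit. -/
def MonotoneCircuit.eval {ι : Type} (C : MonotoneCircuit ι) (x : ι → Bool) : Bool :=
  C.gates.value x C.output

/-- The `n.choose 2` unordered pairs of distinct vertices: the input variables of a circuit that
reads a graph on `n` vertices. -/
abbrev VertexPair (n : ℕ) : Type := {e : Sym2 (Fin n) // ¬ e.IsDiag}

open Classical in
/-- A graph as an assignment of the input variables: `1` on the edges and `0` on the non-edges. -/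
noncomputable def graphInput {n : ℕ} (G : SimpleGraph (Fin n)) : VertexPair n → Bool :=
  fun e => decide (e.1 ∈ G.edgeSet)

/-- The isolated clique on the vertex set `A`: any two distinct vertices of `A` are joined, and
there are no other edges. -/
def isolatedClique {n : ℕ} (A : Finset (Fin n)) : SimpleGraph (Fin n) where
  Adj u v := u ≠ v ∧ u ∈ A ∧ v ∈ A
  symm := ⟨fun _ _ h => ⟨h.1.symm, h.2.2, h.2.1⟩⟩
  loopless := ⟨fun _ h => h.1 rfl⟩

/-- The positive distribution: a uniformly random isolated `β`-clique on `n` vertices. -/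
noncomputable def positiveDist (n β : ℕ) : Measure (SimpleGraph (Fin n)) :=
  uniformOn {G | ∃ A : Finset (Fin n), A.card = β ∧ G = isolatedClique A}

/-- The edge probability `n ^ (-2 / (α - 1))`, as an element of `[0, 1]`.  The projection onto
`[0, 1]` does nothing when `1 ≤ n` and `2 ≤ α`, see `coe_edgeProb`. -/
noncomputable def edgeProb (n α : ℕ) : unitInterval :=
  Set.projIcc 0 1 zero_le_one ((n : ℝ) ^ (-2 / ((α : ℝ) - 1)))

theorem coe_edgeProb {n α : ℕ} (hn : 1 ≤ n) (hα : 2 ≤ α) :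
    (edgeProb n α : ℝ) = (n : ℝ) ^ (-2 / ((α : ℝ) - 1)) := by
  have h1 : (1 : ℝ) ≤ n := by exact_mod_cast hn
  have h2 : (2 : ℝ) ≤ α := by exact_mod_cast hα
  have h3 : -2 / ((α : ℝ) - 1) ≤ 0 := div_nonpos_of_nonpos_of_nonneg (by norm_num) (by linarith)
  have h4 : (n : ℝ) ^ (-2 / ((α : ℝ) - 1)) ∈ Set.Icc (0 : ℝ) 1 :=
    ⟨by positivity, Real.rpow_le_one_of_one_le_of_nonpos h1 h3⟩
  rw [edgeProb, Set.projIcc_of_mem zero_le_one h4]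

/-- The negative distribution: the Erdős–Rényi random graph `G(n, p)` with
`p = n ^ (-2 / (α - 1))`. -/
noncomputable def negativeDist (n α : ℕ) : Measure (SimpleGraph (Fin n)) :=
  SimpleGraph.binomialRandom (Fin n) (edgeProb n α)

/-- The circuit `C` distinguishes the Erdős–Rényi graph `G(n, n ^ (-2 / (α - 1)))` from a
uniformly random isolated `β`-clique: it rejects the former with probability at least `2/3` and
accepts the latter with probability at least `2/3`. -/
def MonotoneCircuit.Distinguishes {n : ℕ} (C : MonotoneCircuit (VertexPair n)) (α β : ℕ) : Prop :=
  2 / 3 ≤ (negativeDist n α).real {G | C.eval (graphInput G) = false} ∧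
  2 / 3 ≤ (positiveDist n β).real {G | C.eval (graphInput G) = true}

/-!
The proof is Razborov's approximation method, with closed families of vertex sets as approximators
and with clique sunflowers whose bound comes from the spread lemma.

**Approximation.** Let `ℓ = 2 * h`, with `h` about `δ * α / 8192`. A family of vertex sets accepts a
graph if some member is a clique in it. A family of sets of size at most `ℓ` is closed if it
contains every `A` with `#A ≤ ℓ` such that it accepts `G ∪ K_A` with probability at least `1 - ε`,
where `G` is the negative random graph and `ε ≤ n ^ (-3 * ℓ)`. A gate is approximated by combining
the families of its two inputs, closing the result, and keeping only the sets of size at most `h`.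
Closing errs on negative inputs only, with probability at most `n ^ (2 * ℓ) * ε ≤ n ^ (-ℓ)`.
Discarding large sets errs on positive inputs only. If a closed family has at most `r ^ m` minimal
members of each size `m`, this error is at most the sum of `(r * β / n) ^ m` over `m > h`
(`exists_isApproximator`). In the end an approximator either accepts everything or accepts few
cliques, so that the size of the circuit is at least the inverse of one of the two errors
(`MonotoneCircuit.size_bound_of_sunflowers`).

**Clique sunflowers.** The bound `r ^ m` holds because a larger family of `m`-sets has a core `Y`
such that `G ∪ K_Y` contains the clique on a member except with probability `ε`; then `Y` lies in
the closed family, and the members above it are not minimal (`exists_clique_sunflower`). To find the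
core, take one above which the family is `r`-spread. If every vertex owns its edges to the smaller
vertices, a vertex of a candidate clique needs at most `ℓ` of its own edges, so that the candidates
do at least as well in `G` as in a random vertex set of density `q = p ^ ℓ`
(`biasedExp_blocks_le`). For random vertex sets the spread lemma applies, in the form proved by
counting minimal fragments (`spread_lemma`): an `r`-spread family has a member in a random set of
density of order `log ℓ / r` with probability at least `2 / 3`. Dividing the random set of density
`q` into `N` independent parts, `N` of order `ℓ * log n`, makes the probability of failure
`3 ^ (-N) ≤ ε`, for `r` of order `ℓ * (log n) ^ 2 / q`.

**Parameters.** With `t = δ * log n` one gets `r * β / n ≤ exp (-t / 2) / 4`: the hypothesis on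
`α * β` gains `exp (-t)`, the density costs `1 / q ≤ exp (t / 8)`, and the second logarithm in `r`
only costs a factor `t`, thanks to the factor `δ` in `ℓ`. Both errors are therefore
`n ^ (-Ω(δ ^ 2 * α))`. When `δ * α` is bounded, so that `h < 2`, the claim follows from the fact
that a circuit of size `s` reads at most `2 * s + 1` edges
(`MonotoneCircuit.size_bound_of_inputs`).
-/

/-! ### Random subsets with independent elements -/

open Finset in
/-- The expectation of `f` at a random subset of `s` that contains every element of `s`
independently with probability `p`, written as a finite sum. -/
noncomputable def biasedExp {α : Type*} (p : ℝ) (s : Finset α) (f : Finset α → ℝ) : ℝ :=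
  ∑ t ∈ s.powerset, p ^ #t * (1 - p) ^ (#s - #t) * f t

section BiasedExp

open Finset

variable {α : Type*} {p : ℝ} {s : Finset α}

@[simp] lemma biasedExp_empty (p : ℝ) (f : Finset α → ℝ) : biasedExp p ∅ f = f ∅ := by
  simp [biasedExp]

lemma biasedExp_insert [DecidableEq α] {a : α} (ha : a ∉ s) (f : Finset α → ℝ) :
    biasedExp p (insert a s) f =
      p * biasedExp p s (fun t => f (insert a t)) + (1 - p) * biasedExp p s f := by
  unfold biasedExp
  rw [sum_powerset_insert ha, add_comm, mul_sum, mul_sum]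
  congr 1
  · refine sum_congr rfl fun t ht => ?_
    have hat : a ∉ t := fun h => ha (mem_powerset.1 ht h)
    rw [card_insert_of_notMem hat, card_insert_of_notMem ha, pow_succ, Nat.add_sub_add_right]
    ring
  · refine sum_congr rfl fun t ht => ?_
    have h1 : #t ≤ #s := card_le_card (mem_powerset.1 ht)
    rw [card_insert_of_notMem ha, Nat.succ_sub h1, pow_succ]
    ring

lemma biasedExp_mono (h0 : 0 ≤ p) (h1 : p ≤ 1) {f g : Finset α → ℝ} (h : ∀ t ⊆ s, f t ≤ g t) :
    biasedExp p s f ≤ biasedExp p s g :=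
  sum_le_sum fun t ht => mul_le_mul_of_nonneg_left (h t (mem_powerset.1 ht))
    (mul_nonneg (pow_nonneg h0 _) (pow_nonneg (by linarith) _))

lemma biasedExp_mul_left (c : ℝ) (f : Finset α → ℝ) :
    biasedExp p s (fun t => c * f t) = c * biasedExp p s f := by
  simp only [biasedExp, mul_sum]
  exact sum_congr rfl fun _ _ => by ring

lemma biasedExp_add (f g : Finset α → ℝ) :
    biasedExp p s (fun t => f t + g t) = biasedExp p s f + biasedExp p s g := by
  simp only [biasedExp, ← sum_add_distrib, mul_add]

lemma biasedExp_sum {ι : Type*} (I : Finset ι) (f : ι → Finset α → ℝ) :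
    biasedExp p s (fun t => ∑ i ∈ I, f i t) = ∑ i ∈ I, biasedExp p s (f i) := by
  simp only [biasedExp, mul_sum]
  exact sum_comm

lemma biasedExp_comm {β : Type*} {q : ℝ} {s' : Finset β} (f : Finset α → Finset β → ℝ) :
    biasedExp p s (fun t => biasedExp q s' (f t)) =
      biasedExp q s' (fun u => biasedExp p s (fun t => f t u)) := by
  simp only [biasedExp, mul_sum]
  rw [sum_comm]
  exact sum_congr rfl fun _ _ => sum_congr rfl fun _ _ => by ring

lemma biasedExp_const (p : ℝ) (s : Finset α) (c : ℝ) : biasedExp p s (fun _ => c) = c := by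
  classical
  induction s using Finset.induction_on with
  | empty => simp
  | insert a s ha ih => rw [biasedExp_insert ha, ih]; ring

lemma biasedExp_nonneg (h0 : 0 ≤ p) (h1 : p ≤ 1) {f : Finset α → ℝ} (h : ∀ t ⊆ s, 0 ≤ f t) :
    0 ≤ biasedExp p s f :=
  (biasedExp_const p s 0).symm.le.trans (biasedExp_mono h0 h1 h)

variable [DecidableEq α]

lemma biasedExp_disjUnion {t : Finset α} (h : Disjoint s t) (f : Finset α → ℝ) :
    biasedExp p (s ∪ t) f = biasedExp p s (fun u => biasedExp p t (fun w => f (u ∪ w))) := by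
  induction s using Finset.induction_on generalizing f with
  | empty => simp
  | insert a s ha ih =>
    rw [disjoint_insert_left] at h
    rw [insert_union, biasedExp_insert (by simp [ha, h.1]), biasedExp_insert ha, ih h.2, ih h.2]
    simp only [insert_union]

/-- For an antitone `f`, a single random set of density `a + b` does at least as well as the union
of two independent random sets of densities `a` and `b`. -/
lemma biasedExp_add_density_le {a b : ℝ} (ha : 0 ≤ a) (hb : 0 ≤ b) (hab : a + b ≤ 1)
    {f : Finset α → ℝ} (hf : Antitone f) :
    biasedExp (a + b) s f ≤ biasedExp a s (fun u => biasedExp b s (fun w => f (u ∪ w))) := by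
  induction s using Finset.induction_on generalizing f with
  | empty => simp
  | insert v s hv ih =>
    have hfv : Antitone fun t => f (insert v t) := fun t t' h => hf (insert_subset_insert v h)
    have e1 := ih hf
    have e2 := ih hfv
    have e3 : biasedExp a s (fun u => biasedExp b s (fun w => f (insert v (u ∪ w)))) ≤
        biasedExp a s (fun u => biasedExp b s (fun w => f (u ∪ w))) :=
      biasedExp_mono ha (by linarith) fun u _ =>
        biasedExp_mono hb (by linarith) fun w _ => hf (subset_insert _ _)
    simp only [biasedExp_insert hv, insert_union, union_insert, insert_idem, biasedExp_add,
      biasedExp_mul_left]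
    nlinarith [mul_nonneg ha hb, mul_le_mul_of_nonneg_left e3 (mul_nonneg ha hb),
      mul_le_mul_of_nonneg_left e2 (add_nonneg ha hb),
      mul_le_mul_of_nonneg_left e1 (sub_nonneg.2 hab)]

lemma biasedExp_mul_density_le_pow {a : ℝ} (ha : 0 ≤ a) {f : Finset α → ℝ} (hf : Antitone f)
    (h0 : ∀ t, 0 ≤ f t) (h1 : ∀ t, f t ≤ 1) (hmul : ∀ u w, f (u ∪ w) ≤ f u * f w) (N : ℕ)
    (hN : N * a ≤ 1) :
    biasedExp (N * a) s f ≤ biasedExp a s f ^ N := by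
  induction N with
  | zero =>
    rw [pow_zero, ← biasedExp_const ((0 : ℕ) * a) s 1]
    exact biasedExp_mono (by simp) hN fun t _ => h1 t
  | succ N ih =>
    have hN' : (N : ℝ) * a + a ≤ 1 := by push_cast at hN; linarith
    have hNa : 0 ≤ (N : ℝ) * a := by positivity
    calc biasedExp ((N + 1 : ℕ) * a) s f = biasedExp (N * a + a) s f := by push_cast; ring_nf
      _ ≤ biasedExp (N * a) s (fun u => biasedExp a s (fun w => f (u ∪ w))) :=
          biasedExp_add_density_le hNa ha hN' hf
      _ ≤ biasedExp (N * a) s (fun u => biasedExp a s f * f u) :=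
          biasedExp_mono hNa (by linarith) fun u _ => by
            rw [mul_comm, ← biasedExp_mul_left]
            exact biasedExp_mono ha (by linarith) fun w _ => hmul u w
      _ = biasedExp a s f * biasedExp (N * a) s f := biasedExp_mul_left _ _
      _ ≤ biasedExp a s f ^ (N + 1) := by
          rw [pow_succ']
          exact mul_le_mul_of_nonneg_left (ih (by linarith))
            (biasedExp_nonneg ha (by linarith) fun t _ => h0 t)

end BiasedExp

/-! ### The spread lemma and robust sunflowers -/

section Spread

open Finset
open scoped Classical

variable {α ι : Type*} [DecidableEq α] {I : Finset ι} {T : ι → Finset α} {s : Finset α} {γ x M : ℝ}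

/-- Minimal fragments: for a set `W` and an index `i`, among the sets `T j ⊆ T i ∪ W` take one that
leaves the smallest part `T j \ W` uncovered.  By minimality this uncovered part is contained in
every `T j` that is covered by `W` together with it. -/
lemma exists_minimal_fragment (I : Finset ι) (T : ι → Finset α) (W : Finset α) {i : ι}
    (hi : i ∈ I) :
    ∃ χ ⊆ T i, Disjoint χ W ∧ (∃ j ∈ I, T j ⊆ W ∪ χ) ∧
      ∀ j ∈ I, T j ⊆ W ∪ χ → χ ⊆ T j := by
  obtain ⟨j, hj, hmin⟩ := exists_min_image {j ∈ I | T j ⊆ T i ∪ W} (fun j => #(T j \ W))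
    ⟨i, by simp [hi, subset_union_left]⟩
  rw [mem_filter] at hj
  refine ⟨T j \ W, ?_, sdiff_disjoint, ⟨j, hj.1, ?_⟩, fun k hk hsub => ?_⟩
  · intro a ha
    have := hj.2 (mem_sdiff.1 ha).1
    exact (mem_union.1 this).resolve_right (mem_sdiff.1 ha).2
  · rw [union_sdiff_self_eq_union]; exact subset_union_right
  · have h1 : T k \ W ⊆ T j \ W := by
      intro a ha
      exact (mem_union.1 (hsub (mem_sdiff.1 ha).1)).resolve_left (mem_sdiff.1 ha).2
    have h2 : T k ⊆ T i ∪ W := by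
      refine hsub.trans (union_subset subset_union_right ?_)
      exact sdiff_subset.trans hj.2
    have h3 := hmin k (by simp [hk, h2])
    rw [← eq_of_subset_of_card_le h1 h3]
    exact sdiff_subset

/-- Large minimal fragments are rare.  A pair `(i, W)` with fragment `χ` is recovered from
`Z = W ∪ χ`, from `χ`, which is a subset of a member of the family inside `Z` that depends on `Z`
only, and from the index `i`, for which spreadness leaves few choices as `χ ⊆ T i`. -/
lemma sum_biasedExp_large_fragment_le {χ : ι → Finset α → Finset α} {k h : ℕ}
    (hγ0 : 0 < γ) (hγ1 : γ ≤ 1) (hx : 0 ≤ x) (hxγ : x ≤ γ) (hM : 0 ≤ M)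
    (hTs : ∀ i ∈ I, T i ⊆ s) (hTk : ∀ i ∈ I, #(T i) ≤ k)
    (hspread : ∀ Z, (#{i ∈ I | Z ⊆ T i} : ℝ) ≤ M * x ^ #Z)
    (hχT : ∀ W, ∀ i ∈ I, χ i W ⊆ T i) (hχW : ∀ W, ∀ i ∈ I, Disjoint (χ i W) W)
    (hχ : ∀ W, ∀ i ∈ I, ∃ j ∈ I, T j ⊆ W ∪ χ i W)
    (hχmin : ∀ W, ∀ i ∈ I, ∀ j ∈ I, T j ⊆ W ∪ χ i W → χ i W ⊆ T j) :
    ∑ i ∈ I, biasedExp γ s (fun W => if h ≤ #(χ i W) then 1 else 0) ≤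
      M * (2 ^ k * (x / γ) ^ h) := by
  have hP : ∀ Z : Finset α, ∃ P : Finset (Finset α), (∀ t ∈ P, h ≤ #t) ∧ #P ≤ 2 ^ k ∧
      ∀ t, h ≤ #t → (∃ j ∈ I, T j ⊆ Z) → (∀ j ∈ I, T j ⊆ Z → t ⊆ T j) → t ∈ P := by
    intro Z
    by_cases hZ : ∃ j ∈ I, T j ⊆ Z
    · obtain ⟨j, hj, hjZ⟩ := hZ
      refine ⟨{t ∈ (T j).powerset | h ≤ #t}, fun t ht => (mem_filter.1 ht).2, ?_,
        fun t ht _ hmin => mem_filter.2 ⟨mem_powerset.2 (hmin j hj hjZ), ht⟩⟩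
      refine (card_filter_le _ _).trans ?_
      rw [card_powerset]
      exact Nat.pow_le_pow_right (by norm_num) (hTk j hj)
    · exact ⟨∅, by simp, by simp, fun t _ h' => absurd h' hZ⟩
  choose P hPh hPk hPmem using hP
  set w : Finset α → ℝ := fun W => γ ^ #W * (1 - γ) ^ (#s - #W) with hw
  have hγ1' : 0 ≤ 1 - γ := by linarith
  have hw0 : ∀ W, 0 ≤ w W := fun W => mul_nonneg (pow_nonneg hγ0.le _) (pow_nonneg hγ1' _)
  have hwunion : ∀ W t : Finset α, Disjoint t W → w W ≤ w (W ∪ t) * (γ ^ #t)⁻¹ := by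
    intro W t hd
    rw [← div_eq_mul_inv, le_div_iff₀ (pow_pos hγ0 _)]
    simp only [hw]
    rw [card_union_of_disjoint hd.symm, pow_add]
    have : (1 - γ) ^ (#s - #W) ≤ (1 - γ) ^ (#s - (#W + #t)) :=
      pow_le_pow_of_le_one hγ1' (by linarith) (by omega)
    calc γ ^ #W * (1 - γ) ^ (#s - #W) * γ ^ #t
        = γ ^ #W * γ ^ #t * (1 - γ) ^ (#s - #W) := by ring
      _ ≤ _ := mul_le_mul_of_nonneg_left this (by positivity)
  have key : ∀ i ∈ I, biasedExp γ s (fun W => if h ≤ #(χ i W) then 1 else 0) ≤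
      ∑ Z ∈ s.powerset, ∑ t ∈ P Z, if t ⊆ T i then w Z * (γ ^ #t)⁻¹ else 0 := by
    intro i hi
    have e1 : biasedExp γ s (fun W => if h ≤ #(χ i W) then 1 else 0) =
        ∑ W ∈ s.powerset with h ≤ #(χ i W), w W := by
      simp only [biasedExp, mul_ite, mul_one, mul_zero, sum_filter, hw]
    obtain ⟨g, hg⟩ : ∃ g : (_ : Finset α) × Finset α → ℝ, ∀ Zt,
        g Zt = if Zt.2 ⊆ T i then w Zt.1 * (γ ^ #Zt.2)⁻¹ else 0 := ⟨_, fun _ => rfl⟩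
    obtain ⟨φ, hφ⟩ : ∃ φ : Finset α → (_ : Finset α) × Finset α,
        ∀ W, φ W = ⟨W ∪ χ i W, χ i W⟩ := ⟨_, fun _ => rfl⟩
    have hinj : Function.Injective φ := by
      intro W W' heq
      rw [hφ, hφ, Sigma.mk.injEq, heq_eq_eq] at heq
      have h1 : (W ∪ χ i W) \ χ i W = W := union_sdiff_cancel_right (hχW W i hi).symm
      have h2 : (W' ∪ χ i W') \ χ i W' = W' := union_sdiff_cancel_right (hχW W' i hi).symm
      rw [← h1, ← h2, heq.1, heq.2]
    have e2 : ∑ Z ∈ s.powerset, ∑ t ∈ P Z, (if t ⊆ T i then w Z * (γ ^ #t)⁻¹ else 0) =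
        ∑ Zt ∈ s.powerset.sigma P, g Zt := by
      rw [sum_sigma]
      simp only [hg]
    rw [e1, e2]
    calc ∑ W ∈ s.powerset with h ≤ #(χ i W), w W
        ≤ ∑ W ∈ s.powerset with h ≤ #(χ i W), g (φ W) := by
          refine sum_le_sum fun W _ => ?_
          rw [hg, hφ, if_pos (hχT W i hi)]
          exact hwunion W _ (hχW W i hi)
      _ = ∑ Zt ∈ {W ∈ s.powerset | h ≤ #(χ i W)}.image φ, g Zt :=
          (sum_image hinj.injOn).symm
      _ ≤ ∑ Zt ∈ s.powerset.sigma P, g Zt := by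
          refine sum_le_sum_of_subset_of_nonneg ?_ fun Zt _ _ => ?_
          · intro Zt hZt
            obtain ⟨W, hW, rfl⟩ := mem_image.1 hZt
            rw [mem_filter, mem_powerset] at hW
            rw [hφ]
            exact mem_sigma.2 ⟨mem_powerset.2 (union_subset hW.1
              ((hχT W i hi).trans (hTs i hi))), hPmem _ _ hW.2 (hχ W i hi) (hχmin W i hi)⟩
          · rw [hg]
            split_ifs
            · exact mul_nonneg (hw0 _) (by positivity)
            · exact le_rfl
  calc ∑ i ∈ I, biasedExp γ s (fun W => if h ≤ #(χ i W) then 1 else 0)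
      ≤ ∑ i ∈ I, ∑ Z ∈ s.powerset, ∑ t ∈ P Z,
          if t ⊆ T i then w Z * (γ ^ #t)⁻¹ else 0 := sum_le_sum key
    _ = ∑ Z ∈ s.powerset, ∑ t ∈ P Z, #{i ∈ I | t ⊆ T i} * (w Z * (γ ^ #t)⁻¹) := by
        rw [sum_comm]
        refine sum_congr rfl fun Z _ => ?_
        rw [sum_comm]
        refine sum_congr rfl fun t _ => ?_
        rw [← sum_filter, sum_const, nsmul_eq_mul]
    _ ≤ ∑ Z ∈ s.powerset, w Z * (M * (2 ^ k * (x / γ) ^ h)) := by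
        refine sum_le_sum fun Z _ => ?_
        have hy0 : 0 ≤ x / γ := by positivity
        calc ∑ t ∈ P Z, (#{i ∈ I | t ⊆ T i} : ℝ) * (w Z * (γ ^ #t)⁻¹)
            ≤ ∑ t ∈ P Z, w Z * (M * (x / γ) ^ h) := by
              refine sum_le_sum fun t ht => ?_
              have h2 : (x / γ) ^ #t ≤ (x / γ) ^ h :=
                pow_le_pow_of_le_one hy0 ((div_le_one hγ0).2 hxγ) (hPh Z t ht)
              calc (#{i ∈ I | t ⊆ T i} : ℝ) * (w Z * (γ ^ #t)⁻¹)
                  ≤ M * x ^ #t * (w Z * (γ ^ #t)⁻¹) :=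
                    mul_le_mul_of_nonneg_right (hspread t) (mul_nonneg (hw0 Z) (by positivity))
                _ = w Z * (M * (x / γ) ^ #t) := by rw [div_pow]; ring
                _ ≤ _ := mul_le_mul_of_nonneg_left (mul_le_mul_of_nonneg_left h2 hM) (hw0 Z)
          _ = #(P Z) * (w Z * (M * (x / γ) ^ h)) := by rw [sum_const, nsmul_eq_mul]
          _ ≤ 2 ^ k * (w Z * (M * (x / γ) ^ h)) :=
              mul_le_mul_of_nonneg_right (by exact_mod_cast hPk Z)
                (mul_nonneg (hw0 Z) (by positivity))
          _ = _ := by ring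
    _ = M * (2 ^ k * (x / γ) ^ h) := biasedExp_const γ s _

/-- The spread lemma, by repeatedly passing to minimal fragments: in each of the `j` rounds the
sizes of most sets are halved.  The bound on `|I|` times the probability of failure, rather than on
that probability, is what the induction needs, because the number of indices drops while the
spreadness parameter `M` stays. -/
lemma spread_lemma (hγ0 : 0 < γ) (hx : 0 ≤ x) (hxγ : 16 * x ≤ γ) (hM : 0 ≤ M) (j : ℕ)
    (hγ1 : j * γ ≤ 1) (hTs : ∀ i ∈ I, T i ⊆ s) (hTj : ∀ i ∈ I, #(T i) < 2 ^ j)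
    (hspread : ∀ Z, (#{i ∈ I | Z ⊆ T i} : ℝ) ≤ M * x ^ #Z) :
    #I * biasedExp (j * γ) s (fun W => if ∃ i ∈ I, T i ⊆ W then 0 else 1) ≤
      M * ∑ r ∈ range j, (1 / 4 : ℝ) ^ (r + 1) := by
  induction j generalizing I T with
  | zero =>
    rcases I.eq_empty_or_nonempty with rfl | ⟨i, hi⟩
    · simp
    · have h0 : T i = ∅ := by simpa using hTj i hi
      have : ∀ W : Finset α, ∃ i ∈ I, T i ⊆ W := fun W => ⟨i, hi, by simp [h0]⟩
      simp [this, biasedExp_const]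
  | succ j ih =>
    have hγ1' : (j : ℝ) * γ + γ ≤ 1 := by push_cast at hγ1; linarith
    have hjγ : 0 ≤ (j : ℝ) * γ := by positivity
    have hγle : γ ≤ 1 := by linarith
    have hex : ∀ i W, ∃ χ : Finset α, i ∈ I → χ ⊆ T i ∧ Disjoint χ W ∧
        (∃ j ∈ I, T j ⊆ W ∪ χ) ∧ ∀ j ∈ I, T j ⊆ W ∪ χ → χ ⊆ T j := fun i W => by
      by_cases hi : i ∈ I
      · obtain ⟨χ, h1, h2⟩ := exists_minimal_fragment I T W hi
        exact ⟨χ, fun _ => ⟨h1, h2⟩⟩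
      · exact ⟨∅, fun h => absurd h hi⟩
    choose χ hχ' using hex
    have hχT : ∀ W, ∀ i ∈ I, χ i W ⊆ T i := fun W i hi => (hχ' i W hi).1
    have hχW : ∀ W, ∀ i ∈ I, Disjoint (χ i W) W := fun W i hi => (hχ' i W hi).2.1
    have hχ : ∀ W, ∀ i ∈ I, ∃ j ∈ I, T j ⊆ W ∪ χ i W := fun W i hi => (hχ' i W hi).2.2.1
    have hχmin : ∀ W, ∀ i ∈ I, ∀ j ∈ I, T j ⊆ W ∪ χ i W → χ i W ⊆ T j :=
      fun W i hi => (hχ' i W hi).2.2.2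
    set f : Finset α → ℝ := fun W => if ∃ i ∈ I, T i ⊆ W then 0 else 1 with hf
    have hfanti : Antitone f := by
      intro W W' hW
      by_cases h : ∃ i ∈ I, T i ⊆ W
      · obtain ⟨i, hi, hiW⟩ := h
        have h1 : ∃ i ∈ I, T i ⊆ W' := ⟨i, hi, hiW.trans hW⟩
        have h2 : ∃ i ∈ I, T i ⊆ W := ⟨i, hi, hiW⟩
        simp [hf, h1, h2]
      · simp only [hf, if_neg h]; split_ifs <;> norm_num
    have hf1 : ∀ W, f W ≤ 1 := fun W => by simp only [hf]; split_ifs <;> norm_num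
    -- the first round succeeds for the index `i` if the fragment is small
    have hround : ∀ W, #I * biasedExp (j * γ) s (fun U => f (W ∪ U)) ≤
        M * ∑ r ∈ range j, (1 / 4 : ℝ) ^ (r + 1) +
          ∑ i ∈ I, if 2 ^ j ≤ #(χ i W) then (1 : ℝ) else 0 := by
      intro W
      set I' : Finset ι := {i ∈ I | #(χ i W) < 2 ^ j} with hI'
      have hsub : I' ⊆ I := filter_subset _ _
      have h1 := ih (I := I') (T := fun i => χ i W) (by linarith)
        (fun i hi => (hχT W i (hsub hi)).trans (hTs i (hsub hi)))
        (fun i hi => (mem_filter.1 hi).2)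
        (fun Z => le_trans (by
          refine Nat.cast_le.2 (card_le_card fun i hi => ?_)
          rw [mem_filter] at hi ⊢
          exact ⟨hsub hi.1, hi.2.trans (hχT W i (hsub hi.1))⟩) (hspread Z))
      have h2 : biasedExp (j * γ) s (fun U => f (W ∪ U)) ≤
          biasedExp (j * γ) s (fun U => if ∃ i ∈ I', χ i W ⊆ U then 0 else 1) := by
        refine biasedExp_mono hjγ (by linarith) fun U _ => ?_
        split_ifs with h
        · obtain ⟨i, hi, hiU⟩ := h
          obtain ⟨k, hk, hkW⟩ := hχ W i (hsub hi)
          have : ∃ i ∈ I, T i ⊆ W ∪ U := ⟨k, hk, hkW.trans (union_subset_union_right hiU)⟩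
          simp only [hf, if_pos this]; exact le_rfl
        · exact hf1 _
      have h3 : biasedExp (j * γ) s (fun U => f (W ∪ U)) ≤ 1 :=
        (biasedExp_mono hjγ (by linarith) fun U _ => hf1 _).trans
          (biasedExp_const (j * γ) s 1).le
      have hcard : (#I : ℝ) = #I' + ∑ i ∈ I, if 2 ^ j ≤ #(χ i W) then (1 : ℝ) else 0 := by
        rw [← sum_filter, sum_const, nsmul_eq_mul, mul_one, hI',
          ← card_filter_add_card_filter_not (fun i => #(χ i W) < 2 ^ j)]
        push_cast
        simp only [not_lt]
      set S := ∑ i ∈ I, if 2 ^ j ≤ #(χ i W) then (1 : ℝ) else 0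
      have hS : 0 ≤ S := sum_nonneg fun i _ => by split_ifs <;> norm_num
      rw [hcard, add_mul]
      have h4 := mul_le_mul_of_nonneg_left h2 (Nat.cast_nonneg (α := ℝ) #I')
      have h5 := mul_le_mul_of_nonneg_left h3 hS
      linarith
    have hlarge := sum_biasedExp_large_fragment_le (s := s) (h := 2 ^ j) (k := 2 ^ (j + 1)) hγ0 hγle
      hx (by linarith) hM hTs (fun i hi => (hTj i hi).le) hspread hχT hχW hχ hχmin
    have hy : 16 * (x / γ) ≤ 1 := by rw [← mul_div_assoc]; exact (div_le_one hγ0).2 hxγ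
    have hy0 : 0 ≤ x / γ := by positivity
    have hnum : (2 : ℝ) ^ (2 ^ (j + 1)) * (x / γ) ^ (2 ^ j) ≤ (1 / 4) ^ (j + 1) := by
      rw [pow_succ 2 j, mul_comm (2 ^ j) 2, pow_mul, ← mul_pow]
      calc ((2 : ℝ) ^ 2 * (x / γ)) ^ 2 ^ j ≤ (1 / 4) ^ 2 ^ j :=
            pow_le_pow_left₀ (by positivity) (by linarith) _
        _ ≤ _ := pow_le_pow_of_le_one (by norm_num) (by norm_num) Nat.lt_two_pow_self
    calc (#I : ℝ) * biasedExp ((j + 1 : ℕ) * γ) s f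
        = #I * biasedExp (γ + j * γ) s f := by push_cast; ring_nf
      _ ≤ #I * biasedExp γ s (fun W => biasedExp (j * γ) s (fun U => f (W ∪ U))) :=
          mul_le_mul_of_nonneg_left
            (biasedExp_add_density_le hγ0.le hjγ (by linarith) hfanti) (Nat.cast_nonneg _)
      _ = biasedExp γ s (fun W => #I * biasedExp (j * γ) s (fun U => f (W ∪ U))) :=
          (biasedExp_mul_left _ _).symm
      _ ≤ biasedExp γ s (fun W => M * ∑ r ∈ range j, (1 / 4 : ℝ) ^ (r + 1) +
          ∑ i ∈ I, if 2 ^ j ≤ #(χ i W) then (1 : ℝ) else 0) :=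
          biasedExp_mono hγ0.le hγle fun W _ => hround W
      _ ≤ M * ∑ r ∈ range j, (1 / 4 : ℝ) ^ (r + 1) + M * (1 / 4) ^ (j + 1) := by
          rw [biasedExp_add, biasedExp_const, biasedExp_sum]
          exact add_le_add le_rfl (hlarge.trans (mul_le_mul_of_nonneg_left hnum hM))
      _ = _ := by rw [sum_range_succ]; ring

lemma sum_range_quarter_pow_le (j : ℕ) : ∑ r ∈ range j, (1 / 4 : ℝ) ^ (r + 1) ≤ 1 / 3 := by
  have h : ∑ r ∈ range j, (1 / 4 : ℝ) ^ (r + 1) = (1 - (1 / 4) ^ j) / 3 := by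
    induction j with
    | zero => simp
    | succ j ih => rw [sum_range_succ, ih]; ring
  rw [h]
  have : (0 : ℝ) ≤ (1 / 4) ^ j := by positivity
  linarith

/-- Robust sunflowers: splitting a random set into `N` independent pieces, each of which contains a
member of a spread family with probability at least `2 / 3`, makes the probability of failure
exponentially small in `N`. -/
lemma spread_lemma_amplified {q : ℝ} {N j : ℕ} (hN : 0 < N) (hj : 0 < j) (hq0 : 0 < q)
    (hq1 : q ≤ 1) (hI : I.Nonempty) (hTs : ∀ i ∈ I, T i ⊆ s) (hTj : ∀ i ∈ I, #(T i) < 2 ^ j)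
    (hspread : ∀ Z, (#{i ∈ I | Z ⊆ T i} : ℝ) * (16 * N * j / q) ^ #Z ≤ #I) :
    biasedExp q s (fun W => if ∃ i ∈ I, T i ⊆ W then 0 else 1) ≤ (1 / 3) ^ N := by
  have hN' : (0 : ℝ) < N := by exact_mod_cast hN
  have hj' : (0 : ℝ) < j := by exact_mod_cast hj
  have hN1 : (1 : ℝ) ≤ N := by exact_mod_cast hN
  have hr : 0 < 16 * N * j / q := by positivity
  have hjγ : (j : ℝ) * (q / (N * j)) = q / N := by field_simp
  have hNq : (N : ℝ) * (q / N) = q := by field_simp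
  have hqN1 : q / N ≤ 1 := (div_le_one hN').2 (by linarith)
  have h1 := spread_lemma (I := I) (T := T) (s := s) (γ := q / (N * j))
    (x := (16 * N * j / q)⁻¹) (M := #I) (by positivity) (by positivity)
    (le_of_eq (by field_simp)) (by positivity) j (by rw [hjγ]; exact hqN1) hTs hTj
    (fun Z => by
      rw [inv_pow, ← div_eq_mul_inv, le_div_iff₀ (by positivity)]
      exact hspread Z)
  rw [hjγ] at h1
  have hIpos : (0 : ℝ) < #I := by exact_mod_cast hI.card_pos
  have h2 : biasedExp (q / N) s (fun W => if ∃ i ∈ I, T i ⊆ W then 0 else 1) ≤ 1 / 3 :=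
    le_of_mul_le_mul_left
      (h1.trans (mul_le_mul_of_nonneg_left (sum_range_quarter_pow_le j) hIpos.le)) hIpos
  have hanti : Antitone fun W : Finset α => if ∃ i ∈ I, T i ⊆ W then (0 : ℝ) else 1 := by
    intro W W' hW
    dsimp only
    split_ifs with h h' h'
    · exact le_rfl
    · exact zero_le_one
    · obtain ⟨i, hi, hiW⟩ := h'
      exact absurd ⟨i, hi, hiW.trans hW⟩ h
    · exact le_rfl
  have h3 := biasedExp_mul_density_le_pow (s := s) (a := q / N) (by positivity) hanti
    (fun W => by split_ifs <;> norm_num) (fun W => by split_ifs <;> norm_num)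
    (fun U W => by
      by_cases hU : ∃ i ∈ I, T i ⊆ U
      · have : ∃ i ∈ I, T i ⊆ U ∪ W := hU.imp fun i hi => ⟨hi.1, hi.2.trans subset_union_left⟩
        simp [hU, this]
      · rw [if_neg hU, one_mul]
        exact hanti subset_union_right) N (by rw [hNq]; exact hq1)
  rw [hNq] at h3
  exact h3.trans (pow_le_pow_left₀ (biasedExp_nonneg (by positivity) hqN1
    fun t _ => by split_ifs <;> norm_num) h2 N)

end Spread

/-! ### Exposing the edges vertex by vertex -/

section VertexExposure

open Finset
open scoped Classical

variable {α : Type*} {p : ℝ} {s : Finset α}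

lemma biasedExp_not_subset [DecidableEq α] (R : Finset α) (hR : R ⊆ s) :
    biasedExp p s (fun F => if R ⊆ F then 0 else 1) = 1 - p ^ #R := by
  induction s using Finset.induction_on generalizing R with
  | empty => simp [subset_empty.1 hR]
  | insert a s ha ih =>
    rw [biasedExp_insert ha]
    by_cases haR : a ∈ R
    · have e1 : biasedExp p s (fun F => if R ⊆ insert a F then (0 : ℝ) else 1) =
          1 - p ^ #(R.erase a) := by
        rw [← ih (R.erase a) (by rwa [← subset_insert_iff])]
        simp only [subset_insert_iff]
      have e2 : biasedExp p s (fun F => if R ⊆ F then (0 : ℝ) else 1) = 1 := by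
        refine (sum_congr rfl fun t ht => ?_).trans (biasedExp_const p s 1)
        have : ¬ R ⊆ t := fun h => ha (mem_powerset.1 ht (h haR))
        simp only [if_neg this]
      rw [e1, e2, ← card_erase_add_one haR, pow_succ]
      ring
    · have e1 : biasedExp p s (fun F => if R ⊆ insert a F then (0 : ℝ) else 1) =
          biasedExp p s (fun F => if R ⊆ F then (0 : ℝ) else 1) := by
        simp only [subset_insert_iff_of_notMem haR]
      rw [e1, ih R ((subset_insert_iff_of_notMem haR).1 hR)]
      ring

/-- Every vertex `v` owns a block `D v` of independent edges.  Asking, for some index `i`, that each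
vertex of `S i` has its at most `m` required edges `R i v` is at least as likely to succeed as
asking that each vertex of `S i` survives an independent `p ^ m`-biased selection.  The comparison
exposes one block at a time: given the other blocks, either some `S i` avoiding `v` already
succeeds, or one fixed requirement `R i v` suffices. -/
lemma biasedExp_blocks_le {V ι : Type*} [DecidableEq α] [DecidableEq V] {m : ℕ} (h0 : 0 ≤ p) (h1 : p ≤ 1) (t : Finset V)
    (D : V → Finset α) (hD : (t : Set V).PairwiseDisjoint D) (I : Set ι) (S : ι → Finset V)
    (R : ι → V → Finset α) (hRD : ∀ i v, R i v ⊆ D v) (hRm : ∀ i v, #(R i v) ≤ m) :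
    biasedExp p (t.biUnion D) (fun F => if ∃ i ∈ I, ∀ v ∈ S i, v ∈ t → R i v ⊆ F then 0 else 1) ≤
      biasedExp (p ^ m) t (fun W => if ∃ i ∈ I, ∀ v ∈ S i, v ∈ t → v ∈ W then 0 else 1) := by
  induction t using Finset.induction_on generalizing I with
  | empty => simp
  | insert v t hv ih =>
    have hq0 : 0 ≤ p ^ m := pow_nonneg h0 m
    have hq1 : p ^ m ≤ 1 := pow_le_one₀ h0 h1
    have hdisj : Disjoint (D v) (t.biUnion D) := by
      rw [disjoint_biUnion_right]
      intro u hu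
      refine hD (by simp) (by simp [hu]) ?_
      rintro rfl
      exact hv hu
    have hD' : (t : Set V).PairwiseDisjoint D := hD.subset (by simp)
    rw [biUnion_insert, biasedExp_disjUnion hdisj, biasedExp_insert hv]
    calc biasedExp p (D v) (fun F => biasedExp p (t.biUnion D) (fun F' =>
            if ∃ i ∈ I, ∀ u ∈ S i, u ∈ insert v t → R i u ⊆ F ∪ F' then 0 else 1))
        ≤ biasedExp p (D v) (fun F => biasedExp p (t.biUnion D) (fun F' =>
            if ∃ i ∈ {i ∈ I | v ∈ S i → R i v ⊆ F}, ∀ u ∈ S i, u ∈ t → R i u ⊆ F'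
              then 0 else 1)) := by
          refine biasedExp_mono h0 h1 fun F _ => biasedExp_mono h0 h1 fun F' _ => ?_
          by_cases h : ∃ i ∈ {i ∈ I | v ∈ S i → R i v ⊆ F}, ∀ u ∈ S i, u ∈ t → R i u ⊆ F'
          · obtain ⟨i, ⟨hi, hiv⟩, hu⟩ := h
            have h' : ∃ i ∈ I, ∀ u ∈ S i, u ∈ insert v t → R i u ⊆ F ∪ F' := by
              refine ⟨i, hi, fun u hui hut => ?_⟩
              rcases mem_insert.1 hut with rfl | hut
              · exact (hiv hui).trans subset_union_left
              · exact (hu u hui hut).trans subset_union_right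
            rw [if_pos h', ite_eq_left_iff.2 fun h'' => absurd ⟨i, ⟨hi, hiv⟩, hu⟩ h'']
          · rw [if_neg h]
            split_ifs <;> norm_num
      _ ≤ biasedExp p (D v) (fun F => biasedExp (p ^ m) t (fun W =>
            if ∃ i ∈ {i ∈ I | v ∈ S i → R i v ⊆ F}, ∀ u ∈ S i, u ∈ t → u ∈ W then 0 else 1)) :=
          biasedExp_mono h0 h1 fun F _ => ih hD' _
      _ = biasedExp (p ^ m) t (fun W => biasedExp p (D v) (fun F =>
            if ∃ i ∈ {i ∈ I | v ∈ S i → R i v ⊆ F}, ∀ u ∈ S i, u ∈ t → u ∈ W then 0 else 1)) :=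
          biasedExp_comm _
      _ ≤ biasedExp (p ^ m) t (fun W =>
            p ^ m * (if ∃ i ∈ I, ∀ u ∈ S i, u ∈ insert v t → u ∈ insert v W then 0 else 1) +
            (1 - p ^ m) * (if ∃ i ∈ I, ∀ u ∈ S i, u ∈ insert v t → u ∈ W then 0 else 1)) := by
          refine biasedExp_mono hq0 hq1 fun W hW => ?_
          have hvW : v ∉ W := fun h => hv (hW h)
          by_cases hA : ∃ i ∈ I, v ∉ S i ∧ ∀ u ∈ S i, u ∈ t → u ∈ W
          · obtain ⟨i, hi, hvi, hu⟩ := hA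
            have : ∀ F, ∃ i ∈ {i ∈ I | v ∈ S i → R i v ⊆ F}, ∀ u ∈ S i, u ∈ t → u ∈ W :=
              fun F => ⟨i, ⟨hi, fun h => absurd h hvi⟩, hu⟩
            simp only [this, if_true, biasedExp_const]
            have : 0 ≤ 1 - p ^ m := by linarith
            exact add_nonneg (mul_nonneg hq0 (by split_ifs <;> norm_num))
              (mul_nonneg this (by split_ifs <;> norm_num))
          · have hno : ¬ ∃ i ∈ I, ∀ u ∈ S i, u ∈ insert v t → u ∈ W := by
              rintro ⟨i, hi, hu⟩
              exact hA ⟨i, hi, fun hvi => hvW (hu v hvi (mem_insert_self _ _)),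
                fun u hui hut => hu u hui (mem_insert_of_mem hut)⟩
            rw [if_neg hno]
            by_cases hB : ∃ i ∈ I, ∀ u ∈ S i, u ∈ t → u ∈ W
            · obtain ⟨i, hi, hu⟩ := hB
              have hB' : ∃ i ∈ I, ∀ u ∈ S i, u ∈ insert v t → u ∈ insert v W := by
                refine ⟨i, hi, fun u hui hut => ?_⟩
                rcases mem_insert.1 hut with rfl | hut
                · exact mem_insert_self _ _
                · exact mem_insert_of_mem (hu u hui hut)
              rw [if_pos hB']
              calc _ ≤ biasedExp p (D v) (fun F => if R i v ⊆ F then 0 else 1) := by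
                    refine biasedExp_mono h0 h1 fun F _ => ?_
                    by_cases hF : R i v ⊆ F
                    · have : ∃ i ∈ {i ∈ I | v ∈ S i → R i v ⊆ F}, ∀ u ∈ S i, u ∈ t → u ∈ W :=
                        ⟨i, ⟨hi, fun _ => hF⟩, hu⟩
                      rw [if_pos this, if_pos hF]
                    · rw [if_neg hF]
                      split_ifs <;> norm_num
                _ = 1 - p ^ #(R i v) := biasedExp_not_subset _ (hRD i v)
                _ ≤ _ := by
                    have := pow_le_pow_of_le_one h0 h1 (hRm i v)
                    linarith
            · have hB' : ¬ ∃ i ∈ I, ∀ u ∈ S i, u ∈ insert v t → u ∈ insert v W := by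
                rintro ⟨i, hi, hu⟩
                refine hB ⟨i, hi, fun u hui hut => ?_⟩
                rcases mem_insert.1 (hu u hui (mem_insert_of_mem hut)) with rfl | h
                · exact absurd hut hv
                · exact h
              rw [if_neg hB']
              refine (biasedExp_mono (g := fun _ => 1) h0 h1 fun F _ => ?_).trans ?_
              · split_ifs <;> norm_num
              · rw [biasedExp_const]; linarith
      _ = _ := by
          rw [biasedExp_add, biasedExp_mul_left, biasedExp_mul_left]

end VertexExposure

/-! ### Clique sunflowers in the binomial random graph -/

section RandomGraph

open Finset
open scoped Classical

variable {n : ℕ}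

instance instMeasurableSingletonClassSimpleGraph {V : Type*} [Countable V] :
    MeasurableSingletonClass (SimpleGraph V) where
  measurableSet_singleton G := by
    have h := (SimpleGraph.measurableEmbedding_edgeSet (V := V)).measurable
      (measurableSet_singleton G.edgeSet)
    convert h using 1
    ext H
    simp

lemma binomialRandom_real_eq_biasedExp (p : unitInterval) (P : SimpleGraph (Fin n) → Prop) :
    (SimpleGraph.binomialRandom (Fin n) p).real {G | P G} =
      biasedExp p ({e | ¬ e.IsDiag} : Finset (Sym2 (Fin n)))
        (fun F => if P (SimpleGraph.fromEdgeSet F) then 1 else 0) := by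
  have hcard : #({e | ¬ e.IsDiag} : Finset (Sym2 (Fin n))) = (Nat.card (Fin n)).choose 2 := by
    rw [← Fintype.card_subtype, Sym2.card_subtype_not_diag, Nat.card_eq_fintype_card]
  have h1 : ({G | P G} : Set (SimpleGraph (Fin n))) = ((univ.filter P : Finset _) : Set _) := by
    ext; simp
  rw [h1, ← sum_measureReal_singleton, sum_filter]
  unfold biasedExp
  refine sum_bij' (fun G _ => G.edgeFinset) (fun F _ => SimpleGraph.fromEdgeSet F) ?_ ?_ ?_ ?_ ?_
  · intro G _
    rw [mem_powerset]
    intro e he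
    simp only [mem_filter, mem_univ, true_and]
    exact G.not_isDiag_of_mem_edgeFinset he
  · simp
  · intro G _
    simp
  · intro F hF
    ext e
    rw [mem_powerset] at hF
    simp only [SimpleGraph.mem_edgeFinset, SimpleGraph.edgeSet_fromEdgeSet, Set.mem_sdiff, mem_coe]
    refine ⟨fun h => h.1, fun h => ⟨h, ?_⟩⟩
    simpa using hF h
  · intro G _
    rw [measureReal_def, SimpleGraph.binomialRandom_singleton, hcard]
    simp only [SimpleGraph.coe_edgeFinset, SimpleGraph.fromEdgeSet_edgeSet, mul_ite, mul_one,
      mul_zero]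
    rw [← SimpleGraph.coe_edgeFinset, Set.ncard_coe_finset]
    simp

/-- A family of `m`-sets with more than `r ^ m` members has a core `Y`, a proper subset of a member,
above which the family is `r`-spread: take `Y` that maximises the number of members containing `Y`,
weighted by `r ^ #Y`. -/
lemma exists_spread_core {V : Type*} [Fintype V] [DecidableEq V] {r : ℝ} (hr : 0 < r) {m : ℕ}
    (𝒮 : Finset (Finset V)) (h𝒮 : ∀ A ∈ 𝒮, #A = m) (hcard : r ^ m < #𝒮) :
    ∃ Y, (∃ A ∈ 𝒮, Y ⊂ A) ∧
      ∀ Z, (#{A ∈ {A ∈ 𝒮 | Y ⊆ A} | Z ⊆ A \ Y} : ℝ) * r ^ #Z ≤ #{A ∈ 𝒮 | Y ⊆ A} := by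
  obtain ⟨Y, -, hY⟩ := exists_max_image (univ : Finset (Finset V))
    (fun Y => (#{A ∈ 𝒮 | Y ⊆ A} : ℝ) * r ^ #Y) ⟨∅, mem_univ _⟩
  have hY0 : r ^ m < (#{A ∈ 𝒮 | Y ⊆ A} : ℝ) * r ^ #Y := by
    refine hcard.trans_le ?_
    simpa using hY ∅ (mem_univ _)
  refine ⟨Y, ?_, fun Z => ?_⟩
  · have hne : {A ∈ 𝒮 | Y ⊆ A}.Nonempty := by
      rw [nonempty_iff_ne_empty]
      intro h
      rw [h] at hY0
      simp only [card_empty, Nat.cast_zero, zero_mul] at hY0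
      exact absurd hY0 (not_lt.2 (by positivity))
    obtain ⟨A, hA⟩ := hne
    rw [mem_filter] at hA
    refine ⟨A, hA.1, hA.2.ssubset_of_ne ?_⟩
    rintro rfl
    have hone : {B ∈ 𝒮 | Y ⊆ B} = {Y} := by
      ext B
      simp only [mem_filter, mem_singleton]
      refine ⟨fun h => (eq_of_subset_of_card_le h.2 ?_).symm, ?_⟩
      · rw [h𝒮 B h.1, h𝒮 Y hA.1]
      · rintro rfl; exact hA
    rw [hone, h𝒮 Y hA.1] at hY0
    simp at hY0
  · by_cases hd : Disjoint Y Z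
    · have h1 := hY (Y ∪ Z) (mem_univ _)
      have h2 : (#{A ∈ {A ∈ 𝒮 | Y ⊆ A} | Z ⊆ A \ Y} : ℝ) ≤ #{A ∈ 𝒮 | Y ∪ Z ⊆ A} := by
        refine Nat.cast_le.2 (card_le_card fun A hA => ?_)
        simp only [mem_filter] at hA ⊢
        exact ⟨hA.1.1, union_subset hA.1.2 (hA.2.trans sdiff_subset)⟩
      refine le_of_mul_le_mul_right ?_ (pow_pos hr #Y)
      refine le_trans ?_ h1
      rw [card_union_of_disjoint hd, pow_add, mul_assoc, mul_comm (r ^ #Z)]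
      exact mul_le_mul_of_nonneg_right h2 (by positivity)
    · have : {A ∈ {A ∈ 𝒮 | Y ⊆ A} | Z ⊆ A \ Y} = ∅ := by
        refine filter_eq_empty_iff.2 fun A _ hZ => hd ?_
        exact disjoint_sdiff.mono_right hZ
      rw [this]
      simp

/-- Clique sunflowers: a large family of `m`-sets has a core `Y`, properly contained in a member,
such that the random graph together with the clique on `Y` contains the clique on some member,
except with probability `3 ^ (-N)`.  A vertex outside `Y` owns its edges to `Y` and to the smaller vertices, so that
`biasedExp_blocks_le` reduces the claim to random vertex sets. -/
lemma exists_clique_sunflower {p : unitInterval} (hp : 0 < (p : ℝ)) {ℓ N j m : ℕ} (hN : 0 < N)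
    (hj : 0 < j) (hℓ : ℓ < 2 ^ j) (hm : m ≤ ℓ) (𝒮 : Finset (Finset (Fin n)))
    (h𝒮 : ∀ A ∈ 𝒮, #A = m) (hcard : (16 * N * j / (p : ℝ) ^ ℓ) ^ m < #𝒮) :
    ∃ Y, (∃ A ∈ 𝒮, Y ⊂ A) ∧
      (SimpleGraph.binomialRandom (Fin n) p).real
        {G | ¬ ∃ A ∈ 𝒮, isolatedClique A ≤ G ⊔ isolatedClique Y} ≤ (1 / 3) ^ N := by
  have hp1 : (p : ℝ) ≤ 1 := p.2.2
  have hN' : (0 : ℝ) < N := by exact_mod_cast hN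
  have hj' : (0 : ℝ) < j := by exact_mod_cast hj
  obtain ⟨Y, ⟨A₀, hA₀, hYA₀⟩, hspread⟩ := exists_spread_core (by positivity) 𝒮 h𝒮 hcard
  refine ⟨Y, ⟨A₀, hA₀, hYA₀⟩, ?_⟩
  set I : Finset (Finset (Fin n)) := {A ∈ 𝒮 | Y ⊆ A} with hI
  have hI0 : I.Nonempty := ⟨A₀, mem_filter.2 ⟨hA₀, hYA₀.subset⟩⟩
  set D : Fin n → Finset (Sym2 (Fin n)) := fun v =>
    if v ∈ Y then ∅ else ({u | u ≠ v ∧ (u ∈ Y ∨ u < v)} : Finset (Fin n)).image (fun u => s(u, v))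
    with hDdef
  set R : Finset (Fin n) → Fin n → Finset (Sym2 (Fin n)) := fun A v =>
    if A ∈ 𝒮 ∧ v ∉ Y then {u ∈ A | u ≠ v ∧ (u ∈ Y ∨ u < v)}.image (fun u => s(u, v)) else ∅
    with hRdef
  have hDdisj : ((univ : Finset (Fin n)) : Set (Fin n)).PairwiseDisjoint D := by
    intro v _ w _ hvw
    change Disjoint (D v) (D w)
    rw [disjoint_left]
    intro e he he'
    simp only [hDdef] at he he'
    split_ifs at he he' with hv hw
    · simp at he
    · simp at he
    · simp at he'
    · simp only [mem_image, mem_filter, mem_univ, true_and] at he he'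
      obtain ⟨u, hu, rfl⟩ := he
      obtain ⟨u', hu', h⟩ := he'
      rw [Sym2.eq_iff] at h
      rcases h with ⟨-, h⟩ | ⟨rfl, rfl⟩
      · exact hvw h.symm
      · rcases hu.2 with h | h
        · contradiction
        · rcases hu'.2 with h' | h'
          · contradiction
          · exact lt_asymm h h'
  have hRD : ∀ A v, R A v ⊆ D v := by
    intro A v
    simp only [hRdef, hDdef]
    by_cases hv : v ∈ Y
    · simp [hv]
    · simp only [hv, not_false_eq_true, and_true, if_false]
      split_ifs
      · exact image_subset_image (filter_subset_filter _ (subset_univ _))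
      · exact empty_subset _
  have hRm : ∀ A v, #(R A v) ≤ ℓ := by
    intro A v
    simp only [hRdef]
    split_ifs with h
    · exact card_image_le.trans ((card_filter_le _ _).trans ((h𝒮 A h.1).le.trans hm))
    · simp
  have hblocks := biasedExp_blocks_le hp.le hp1 univ D hDdisj (I : Set (Finset (Fin n)))
    (fun A => A \ Y) R hRD hRm
  have hvert := spread_lemma_amplified (I := I) (T := fun A => A \ Y) (s := univ)
    (q := (p : ℝ) ^ ℓ) hN hj (by positivity) (pow_le_one₀ hp.le hp1) hI0
    (fun _ _ => subset_univ _)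
    (fun A hA => lt_of_le_of_lt ((card_le_card sdiff_subset).trans
      ((h𝒮 A (mem_filter.1 hA).1).le.trans hm)) hℓ) hspread
  have hDX : univ.biUnion D ⊆ ({e | ¬ e.IsDiag} : Finset (Sym2 (Fin n))) := by
    intro e he
    obtain ⟨v, -, he⟩ := mem_biUnion.1 he
    simp only [hDdef] at he
    split_ifs at he
    · simp at he
    · simp only [mem_image, mem_filter, mem_univ, true_and] at he
      obtain ⟨u, hu, rfl⟩ := he
      simpa using hu.1
  rw [binomialRandom_real_eq_biasedExp, ← union_sdiff_of_subset hDX,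
    biasedExp_disjUnion disjoint_sdiff]
  refine le_trans ?_ (hblocks.trans ((le_of_eq ?_).trans hvert))
  · refine biasedExp_mono hp.le hp1 fun F _ => ?_
    refine (biasedExp_mono (g := fun _ => _) hp.le hp1 fun F' _ => ?_).trans
      (biasedExp_const (p : ℝ) _ _).le
    by_cases h : ∃ i ∈ (I : Set (Finset (Fin n))), ∀ v ∈ i \ Y, v ∈ univ → R i v ⊆ F
    · rw [if_pos h]
      obtain ⟨A, hA, hAF⟩ := h
      have hA' : A ∈ 𝒮 := (mem_filter.1 (mem_coe.1 hA)).1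
      rw [if_neg]
      rw [not_not]
      refine ⟨A, hA', fun u v huv => ?_⟩
      rw [SimpleGraph.sup_adj]
      by_cases hY : u ∈ Y ∧ v ∈ Y
      · exact Or.inr ⟨huv.1, hY.1, hY.2⟩
      · left
        rw [SimpleGraph.fromEdgeSet_adj]
        refine ⟨?_, huv.1⟩
        -- the owner of the edge is the endpoint outside `Y`, and the larger one of two such
        have own : ∀ x y : Fin n, x ≠ y → x ∈ A → y ∈ A → y ∉ Y → (x ∈ Y ∨ x < y) →
            s(x, y) ∈ F ∪ F' := by
          intro x y hxy hx hy hyY hxy'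
          refine mem_union_left _ (hAF y (mem_sdiff.2 ⟨hy, hyY⟩) (mem_univ _) ?_)
          simp only [hRdef, if_pos (And.intro hA' hyY)]
          exact mem_image.2 ⟨x, mem_filter.2 ⟨hx, hxy, hxy'⟩, rfl⟩
        rw [mem_coe]
        obtain ⟨hne, hu, hv⟩ := huv
        by_cases huY : u ∈ Y
        · exact own u v hne hu hv (fun h => hY ⟨huY, h⟩) (Or.inl huY)
        · by_cases hvY : v ∈ Y
          · rw [Sym2.eq_swap]; exact own v u hne.symm hv hu huY (Or.inl hvY)
          · rcases lt_or_gt_of_ne hne with h | h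
            · exact own u v hne hu hv hvY (Or.inr h)
            · rw [Sym2.eq_swap]; exact own v u hne.symm hv hu huY (Or.inr h)
    · rw [if_neg h]
      split_ifs <;> norm_num
  · congr 1
    funext W
    simp only [mem_univ, true_imp_iff, mem_coe]
    exact if_congr Iff.rfl rfl rfl

end RandomGraph

/-! ### Closed families of vertex sets -/

section CliqueFamilies

open Finset
open scoped Classical

variable {n : ℕ}

lemma isolatedClique_mono {A B : Finset (Fin n)} (h : A ⊆ B) :
    isolatedClique A ≤ isolatedClique B :=
  fun _ _ huv => ⟨huv.1, h huv.2.1, h huv.2.2⟩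

lemma isolatedClique_le_of_card_le_one {A : Finset (Fin n)} (h : #A ≤ 1)
    (G : SimpleGraph (Fin n)) : isolatedClique A ≤ G :=
  fun _ _ huv => absurd (card_le_one.1 h _ huv.2.1 _ huv.2.2) huv.1

lemma subset_of_isolatedClique_le {A B : Finset (Fin n)} (hA : 2 ≤ #A)
    (h : isolatedClique A ≤ isolatedClique B) : A ⊆ B := by
  intro u hu
  obtain ⟨v, hv, hvu⟩ := exists_mem_ne (by omega : 1 < #A) u
  exact (h (show (isolatedClique A).Adj u v from ⟨hvu.symm, hu, hv⟩)).2.1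

/-- The approximators of the gates: a family of vertex sets accepts the graphs in which some member
is a clique. -/
def Accepts (𝓕 : Finset (Finset (Fin n))) (G : SimpleGraph (Fin n)) : Prop :=
  ∃ A ∈ 𝓕, isolatedClique A ≤ G

lemma Accepts.mono {𝓕 𝓖 : Finset (Finset (Fin n))} {G : SimpleGraph (Fin n)} (h : 𝓕 ⊆ 𝓖) :
    Accepts 𝓕 G → Accepts 𝓖 G :=
  fun ⟨A, hA, hAG⟩ => ⟨A, h hA, hAG⟩

/-- A family of vertex sets of size at most `ℓ` is closed if it contains every such set `A` for
which it accepts `G ∪ K_A` except with probability `ε`, where `G` has law `μ`. -/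
structure IsClosedFamily (μ : Measure (SimpleGraph (Fin n))) (ε : ℝ) (ℓ : ℕ)
    (𝓕 : Finset (Finset (Fin n))) : Prop where
  card_le : ∀ A ∈ 𝓕, #A ≤ ℓ
  mem : ∀ A : Finset (Fin n), #A ≤ ℓ →
    μ.real {G | ¬ Accepts 𝓕 (G ⊔ isolatedClique A)} ≤ ε → A ∈ 𝓕

/-- The property of the clique-sunflower lemma: a family of more than `r ^ m` sets of size `m ≤ ℓ`
has a core `Y`, properly contained in a member, such that `G ∪ K_Y` contains the clique on a member
except with probability `ε`. -/
def HasCliqueSunflowers (μ : Measure (SimpleGraph (Fin n))) (ε : ℝ) (ℓ : ℕ) (r : ℝ) : Prop :=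
  ∀ m ≤ ℓ, ∀ 𝒮 : Finset (Finset (Fin n)), (∀ A ∈ 𝒮, #A = m) → r ^ m < #𝒮 →
    ∃ Y, (∃ A ∈ 𝒮, Y ⊂ A) ∧
      μ.real {G | ¬ ∃ A ∈ 𝒮, isolatedClique A ≤ G ⊔ isolatedClique Y} ≤ ε

variable {μ ν : Measure (SimpleGraph (Fin n))} {ε r b : ℝ} {ℓ h : ℕ}
  {𝓕 𝓗 : Finset (Finset (Fin n))}

/-- Adding one missing set to a family that is not closed changes the decision on `G` with
probability at most `ε`, and there are few sets to add. -/
lemma exists_isClosedFamily_superset [IsFiniteMeasure μ] (hε : 0 ≤ ε) (h𝓕 : ∀ A ∈ 𝓕, #A ≤ ℓ) :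
    ∃ 𝓗, 𝓕 ⊆ 𝓗 ∧ IsClosedFamily μ ε ℓ 𝓗 ∧
      μ.real {G | Accepts 𝓗 G ∧ ¬ Accepts 𝓕 G} ≤
        #({A | #A ≤ ℓ} : Finset (Finset (Fin n))) * ε := by
  set U : Finset (Finset (Fin n)) := {A | #A ≤ ℓ} with hU
  have main : ∀ k : ℕ, ∀ 𝓕 : Finset (Finset (Fin n)), (∀ A ∈ 𝓕, #A ≤ ℓ) → #(U \ 𝓕) ≤ k →
      ∃ 𝓗, 𝓕 ⊆ 𝓗 ∧ IsClosedFamily μ ε ℓ 𝓗 ∧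
        μ.real {G | Accepts 𝓗 G ∧ ¬ Accepts 𝓕 G} ≤ k * ε := by
    intro k
    induction k with
    | zero =>
      intro 𝓕 h𝓕 hk
      refine ⟨𝓕, Subset.rfl, ⟨h𝓕, fun A hA _ => ?_⟩, ?_⟩
      · have : U ⊆ 𝓕 := by simpa using hk
        exact this (by simp [hU, hA])
      · simp
    | succ k ih =>
      intro 𝓕 h𝓕 hk
      by_cases hcl : ∀ A : Finset (Fin n), #A ≤ ℓ →
          μ.real {G | ¬ Accepts 𝓕 (G ⊔ isolatedClique A)} ≤ ε → A ∈ 𝓕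
      · refine ⟨𝓕, Subset.rfl, ⟨h𝓕, hcl⟩, ?_⟩
        have : {G | Accepts 𝓕 G ∧ ¬ Accepts 𝓕 G} = ∅ := by ext; simp
        rw [this, measureReal_empty]
        positivity
      · push Not at hcl
        obtain ⟨A, hA, hAε, hA𝓕⟩ := hcl
        have hlt : #(U \ insert A 𝓕) ≤ k := by
          have : #(U \ insert A 𝓕) < #(U \ 𝓕) := by
            refine card_lt_card (Finset.ssubset_iff_subset_ne.2
              ⟨sdiff_subset_sdiff Subset.rfl (subset_insert _ _), fun heq => ?_⟩)
            have : A ∈ U \ 𝓕 := by simp [hU, hA, hA𝓕]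
            rw [← heq] at this
            simp at this
          omega
        obtain ⟨𝓗, hsub, hclosed, hμ⟩ := ih (insert A 𝓕)
          (fun B hB => by
            rcases mem_insert.1 hB with rfl | hB
            · exact hA
            · exact h𝓕 B hB) hlt
        refine ⟨𝓗, (subset_insert _ _).trans hsub, hclosed, ?_⟩
        have hincl : {G | Accepts 𝓗 G ∧ ¬ Accepts 𝓕 G} ⊆
            {G | Accepts 𝓗 G ∧ ¬ Accepts (insert A 𝓕) G} ∪
              {G | ¬ Accepts 𝓕 (G ⊔ isolatedClique A)} := by
          rintro G ⟨h1, h2⟩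
          by_cases h3 : Accepts (insert A 𝓕) G
          · right
            obtain ⟨B, hB, hBG⟩ := h3
            rcases mem_insert.1 hB with rfl | hB
            · simpa [sup_eq_left.2 hBG] using h2
            · exact absurd ⟨B, hB, hBG⟩ h2
          · exact Or.inl ⟨h1, h3⟩
        calc μ.real {G | Accepts 𝓗 G ∧ ¬ Accepts 𝓕 G}
            ≤ _ := measureReal_mono hincl
          _ ≤ _ := measureReal_union_le _ _
          _ ≤ k * ε + ε := add_le_add hμ hAε
          _ = ((k + 1 : ℕ) : ℝ) * ε := by push_cast; ring
  exact (main #U 𝓕 h𝓕 (card_le_card sdiff_subset))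

/-- A closed family has few minimal members of each size: otherwise these contain a clique sunflower
whose core belongs to the family, although it is properly contained in a minimal member. -/
lemma IsClosedFamily.card_minimal_le [IsFiniteMeasure μ] (h𝓗 : IsClosedFamily μ ε ℓ 𝓗)
    (hsun : HasCliqueSunflowers μ ε ℓ r) {m : ℕ} (hm : m ≤ ℓ) :
    (#{A ∈ 𝓗 | (∀ B ∈ 𝓗, ¬ B ⊂ A) ∧ #A = m} : ℝ) ≤ r ^ m := by
  by_contra! hlt
  obtain ⟨Y, ⟨A, hA, hYA⟩, hY⟩ := hsun m hm _ (fun A hA => (mem_filter.1 hA).2.2) hlt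
  rw [mem_filter] at hA
  refine hA.2.1 Y (h𝓗.mem Y ?_ ((measureReal_mono fun G hG => ?_).trans hY)) hYA
  · exact (card_le_card hYA.subset).trans (h𝓗.card_le A hA.1)
  · rintro ⟨B, hB, hBG⟩
    exact hG ⟨B, (mem_filter.1 hB).1, hBG⟩

lemma exists_minimal_of_accepts {G : SimpleGraph (Fin n)} (hG : Accepts 𝓗 G) :
    ∃ A ∈ 𝓗, (∀ B ∈ 𝓗, ¬ B ⊂ A) ∧ isolatedClique A ≤ G := by
  obtain ⟨A₀, hA₀, hA₀G⟩ := hG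
  obtain ⟨A, hA, hmin⟩ := exists_min_image {A ∈ 𝓗 | isolatedClique A ≤ G} card
    ⟨A₀, mem_filter.2 ⟨hA₀, hA₀G⟩⟩
  rw [mem_filter] at hA
  refine ⟨A, hA.1, fun B hB hBA => ?_, hA.2⟩
  have := hmin B (mem_filter.2 ⟨hB, (isolatedClique_mono hBA.subset).trans hA.2⟩)
  exact absurd (card_lt_card hBA) (not_lt.2 this)

/-- Under a law that contains each clique `K_A` with probability at most `b ^ #A`, the minimal
members of a closed family that have at least `a` elements rarely show up. -/
lemma IsClosedFamily.measureReal_minimal_le [IsFiniteMeasure μ] [IsFiniteMeasure ν]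
    (h𝓗 : IsClosedFamily μ ε ℓ 𝓗) (hsun : HasCliqueSunflowers μ ε ℓ r) (hr : 0 ≤ r) (hb : 0 ≤ b)
    (hrb : r * b ≤ 1 / 2)
    (hν : ∀ A : Finset (Fin n), 2 ≤ #A → ν.real {G | isolatedClique A ≤ G} ≤ b ^ #A)
    {a : ℕ} (ha : 2 ≤ a) :
    ν.real {G | ∃ A ∈ 𝓗, (∀ B ∈ 𝓗, ¬ B ⊂ A) ∧ a ≤ #A ∧ isolatedClique A ≤ G} ≤
      2 * (r * b) ^ a := by
  have hincl : {G | ∃ A ∈ 𝓗, (∀ B ∈ 𝓗, ¬ B ⊂ A) ∧ a ≤ #A ∧ isolatedClique A ≤ G} ⊆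
      ⋃ m ∈ Ico a (ℓ + 1), ⋃ A ∈ ({A ∈ 𝓗 | (∀ B ∈ 𝓗, ¬ B ⊂ A) ∧ #A = m} :
        Finset (Finset (Fin n))), {G | isolatedClique A ≤ G} := by
    rintro G ⟨A, hA, hmin, haA, hAG⟩
    simp only [Set.mem_iUnion]
    exact ⟨#A, mem_Ico.2 ⟨haA, Nat.lt_succ_of_le (h𝓗.card_le A hA)⟩, A,
      mem_filter.2 ⟨hA, hmin, rfl⟩, hAG⟩
  have hrb0 : 0 ≤ r * b := mul_nonneg hr hb
  calc _ ≤ _ := measureReal_mono hincl (measure_ne_top _ _)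
    _ ≤ ∑ m ∈ Ico a (ℓ + 1), ν.real (⋃ A ∈ ({A ∈ 𝓗 | (∀ B ∈ 𝓗, ¬ B ⊂ A) ∧ #A = m} :
        Finset (Finset (Fin n))), {G | isolatedClique A ≤ G}) :=
        measureReal_biUnion_finset_le _ _
    _ ≤ ∑ m ∈ Ico a (ℓ + 1), (r * b) ^ m := by
        refine sum_le_sum fun m hm => ?_
        rw [mem_Ico] at hm
        calc _ ≤ ∑ A ∈ ({A ∈ 𝓗 | (∀ B ∈ 𝓗, ¬ B ⊂ A) ∧ #A = m} : Finset (Finset (Fin n))),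
              ν.real {G | isolatedClique A ≤ G} := measureReal_biUnion_finset_le _ _
          _ ≤ ∑ A ∈ ({A ∈ 𝓗 | (∀ B ∈ 𝓗, ¬ B ⊂ A) ∧ #A = m} : Finset (Finset (Fin n))), b ^ m := by
              refine sum_le_sum fun A hA => ?_
              have hAm := (mem_filter.1 hA).2.2
              have h2 := hν A (by omega)
              rwa [hAm] at h2
          _ = #{A ∈ 𝓗 | (∀ B ∈ 𝓗, ¬ B ⊂ A) ∧ #A = m} * b ^ m := by
              rw [sum_const, nsmul_eq_mul]
          _ ≤ r ^ m * b ^ m := mul_le_mul_of_nonneg_right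
              (h𝓗.card_minimal_le hsun (by omega)) (pow_nonneg hb _)
          _ = (r * b) ^ m := (mul_pow _ _ _).symm
    _ ≤ (r * b) ^ a / (1 - r * b) := geom_sum_Ico_le_of_lt_one hrb0 (by linarith)
    _ ≤ 2 * (r * b) ^ a := by
        rw [div_le_iff₀ (by linarith)]
        nlinarith [pow_nonneg hrb0 a]

end CliqueFamilies

/-! ### Approximators of gates -/

section Approximators

open Finset
open scoped Classical

variable {n : ℕ} {μ ν : Measure (SimpleGraph (Fin n))} {ε r b : ℝ} {h : ℕ}
  {𝓕 : Finset (Finset (Fin n))}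

/-- The families used as approximators: the family of a single edge, for an input node, and the sets
of size at most `h` in a closed family of sets of size at most `2 * h`, for a gate. -/
def IsApproximator (μ : Measure (SimpleGraph (Fin n))) (ε : ℝ) (h : ℕ)
    (𝓕 : Finset (Finset (Fin n))) : Prop :=
  (∃ e : VertexPair n, 𝓕 = {e.1.toFinset}) ∨
    ∃ 𝓗, IsClosedFamily μ ε (2 * h) 𝓗 ∧ 𝓕 = {A ∈ 𝓗 | #A ≤ h}

lemma accepts_edge_iff (e : VertexPair n) (G : SimpleGraph (Fin n)) :
    Accepts {e.1.toFinset} G ↔ graphInput G e = true := by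
  obtain ⟨e, he⟩ := e
  induction e using Sym2.ind with
  | _ u v =>
    have huv : u ≠ v := by simpa using he
    simp only [Accepts, mem_singleton, exists_eq_left, graphInput, decide_eq_true_eq,
      SimpleGraph.mem_edgeSet]
    constructor
    · intro hle
      exact hle (show (isolatedClique _).Adj u v from ⟨huv, by simp, by simp⟩)
    · rintro hG x y ⟨hxy, hx, hy⟩
      simp only [Sym2.mem_toFinset, Sym2.mem_iff] at hx hy
      rcases hx with rfl | rfl <;> rcases hy with rfl | rfl
      · exact absurd rfl hxy
      · exact hG
      · exact hG.symm
      · exact absurd rfl hxy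

lemma card_edge (e : VertexPair n) : #e.1.toFinset = 2 := Sym2.card_toFinset_of_not_isDiag _ e.2

lemma IsApproximator.card_le (hh : 2 ≤ h) (h𝓕 : IsApproximator μ ε h 𝓕) : ∀ A ∈ 𝓕, #A ≤ h := by
  rcases h𝓕 with ⟨e, rfl⟩ | ⟨𝓗, -, rfl⟩
  · intro A hA
    rw [mem_singleton.1 hA, card_edge]
    exact hh
  · exact fun A hA => (mem_filter.1 hA).2

/-- A closed family with a member of size at most one contains the empty set, because such a member
is accepted by every graph. -/
lemma IsApproximator.exists_subset [IsFiniteMeasure μ] (hε : 0 ≤ ε)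
    (h𝓕 : IsApproximator μ ε h 𝓕) {B : Finset (Fin n)} (hB : Accepts 𝓕 (isolatedClique B)) :
    ∃ A ∈ 𝓕, A ⊆ B := by
  obtain ⟨A, hA, hAB⟩ := hB
  by_cases h2 : 2 ≤ #A
  · exact ⟨A, hA, subset_of_isolatedClique_le h2 hAB⟩
  · rcases h𝓕 with ⟨e, rfl⟩ | ⟨𝓗, h𝓗, rfl⟩
    · rw [mem_singleton.1 hA, card_edge] at h2
      exact absurd le_rfl h2
    · refine ⟨∅, mem_filter.2 ⟨h𝓗.mem ∅ (by simp) ?_, by simp⟩, empty_subset _⟩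
      have : {G | ¬ Accepts 𝓗 (G ⊔ isolatedClique ∅)} = ∅ := by
        refine Set.eq_empty_of_forall_notMem fun G hG => hG ?_
        exact ⟨A, (mem_filter.1 hA).1, isolatedClique_le_of_card_le_one (by omega) _⟩
      rw [this, measureReal_empty]
      exact hε

/-- The approximator of a gate: close a family of sets of size at most `2 * h`, which errs on the
negative side only, and discard the sets with more than `h` elements, which errs on the positive
side only. -/
lemma exists_isApproximator [IsFiniteMeasure μ] [IsFiniteMeasure ν] (hε : 0 ≤ ε)
    (hh : 2 ≤ h) (hsun : HasCliqueSunflowers μ ε (2 * h) r) (hr : 0 ≤ r) (hb : 0 ≤ b)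
    (hrb : r * b ≤ 1 / 2)
    (hν : ∀ A : Finset (Fin n), 2 ≤ #A → ν.real {G | isolatedClique A ≤ G} ≤ b ^ #A)
    (h𝓕 : ∀ A ∈ 𝓕, #A ≤ 2 * h) :
    ∃ 𝓖, IsApproximator μ ε h 𝓖 ∧
      μ.real {G | Accepts 𝓖 G ∧ ¬ Accepts 𝓕 G} ≤
        #({A | #A ≤ 2 * h} : Finset (Finset (Fin n))) * ε ∧
      ν.real {G | Accepts 𝓕 G ∧ ¬ Accepts 𝓖 G} ≤ 2 * (r * b) ^ (h + 1) := by
  obtain ⟨𝓗, hsub, h𝓗, hμ⟩ := exists_isClosedFamily_superset (μ := μ) hε h𝓕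
  refine ⟨{A ∈ 𝓗 | #A ≤ h}, Or.inr ⟨𝓗, h𝓗, rfl⟩, ?_, ?_⟩
  · refine (measureReal_mono fun G hG => ?_).trans hμ
    exact ⟨hG.1.mono (filter_subset _ _), hG.2⟩
  · refine (measureReal_mono fun G hG => ?_).trans
      (h𝓗.measureReal_minimal_le hsun hr hb hrb hν (a := h + 1) (by omega))
    obtain ⟨A, hA, hmin, hAG⟩ := exists_minimal_of_accepts (hG.1.mono hsub)
    refine ⟨A, hA, hmin, ?_, hAG⟩
    by_contra hlt
    exact hG.2 ⟨A, mem_filter.2 ⟨hA, by omega⟩, hAG⟩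

end Approximators

/-! ### Approximation of monotone circuits -/

section Circuits

open Finset
open scoped Classical

variable {n : ℕ} {μ ν : Measure (SimpleGraph (Fin n))} {ε r b : ℝ} {h : ℕ}

lemma Gates.value_inl {ι : Type} {s : ℕ} (P : Gates ι s) (x : ι → Bool) (i : ι) :
    P.value x (Sum.inl i) = x i := by
  cases P <;> rfl

/-- `P.Approximable μ ν ε h e₀ e₁` says that all nodes of `P` have approximators such that, up to
probability `s * e₀` under `μ`, no node with value `0` is accepted, and up to probability `s * e₁`
under `ν`, restricted to isolated cliques, every node with value `1` is accepted, `s` being the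
number of gates. -/
def Gates.Approximable {s : ℕ} (P : Gates (VertexPair n) s)
    (μ ν : Measure (SimpleGraph (Fin n))) (ε : ℝ) (h : ℕ) (e₀ e₁ : ℝ) : Prop :=
  ∃ a : VertexPair n ⊕ Fin s → Finset (Finset (Fin n)),
    (∀ u, IsApproximator μ ε h (a u)) ∧ (∀ e, a (Sum.inl e) = {e.1.toFinset}) ∧
    μ.real {G | ∃ u, P.value (graphInput G) u = false ∧ Accepts (a u) G} ≤ s * e₀ ∧
    ν.real {G | (∃ B, G = isolatedClique B) ∧
      ∃ u, P.value (graphInput G) u = true ∧ ¬ Accepts (a u) G} ≤ s * e₁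

/-- One more gate with an approximator of a family `𝓕` that computes the gate exactly, wherever the
approximators of the previous nodes make no error. -/
lemma Gates.approximable_succ [IsFiniteMeasure μ] [IsFiniteMeasure ν] {s : ℕ} {e₀ e₁ : ℝ}
    {P : Gates (VertexPair n) s} {P' : Gates (VertexPair n) (s + 1)}
    (hP' : ∀ x j, P'.value x (Sum.inr (Fin.castSucc j)) = P.value x (Sum.inr j))
    {a : VertexPair n ⊕ Fin s → Finset (Finset (Fin n))}
    (ha : ∀ u, IsApproximator μ ε h (a u)) (hin : ∀ e, a (Sum.inl e) = {e.1.toFinset})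
    (hneg : μ.real {G | ∃ u, P.value (graphInput G) u = false ∧ Accepts (a u) G} ≤ s * e₀)
    (hpos : ν.real {G | (∃ B, G = isolatedClique B) ∧
      ∃ u, P.value (graphInput G) u = true ∧ ¬ Accepts (a u) G} ≤ s * e₁)
    {𝓕 𝓖 : Finset (Finset (Fin n))} (h𝓖 : IsApproximator μ ε h 𝓖)
    (h₀ : μ.real {G | Accepts 𝓖 G ∧ ¬ Accepts 𝓕 G} ≤ e₀)
    (h₁ : ν.real {G | Accepts 𝓕 G ∧ ¬ Accepts 𝓖 G} ≤ e₁)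
    (hval₀ : ∀ G, (∀ u, Accepts (a u) G → P.value (graphInput G) u = true) → Accepts 𝓕 G →
      P'.value (graphInput G) (Sum.inr (Fin.last s)) = true)
    (hval₁ : ∀ B, (∀ u, P.value (graphInput (isolatedClique B)) u = true →
        Accepts (a u) (isolatedClique B)) →
      P'.value (graphInput (isolatedClique B)) (Sum.inr (Fin.last s)) = true →
      Accepts 𝓕 (isolatedClique B)) :
    P'.Approximable μ ν ε h e₀ e₁ := by
  set a' : VertexPair n ⊕ Fin (s + 1) → Finset (Finset (Fin n)) :=
    Sum.elim (fun e => {e.1.toFinset})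
      (fun k => Fin.lastCases (motive := fun _ => Finset (Finset (Fin n))) 𝓖
        (fun j => a (Sum.inr j)) k) with ha'
  have ha'l : a' (Sum.inr (Fin.last s)) = 𝓖 := by simp [ha']
  have ha'c : ∀ j, a' (Sum.inr (Fin.castSucc j)) = a (Sum.inr j) := fun j => by simp [ha']
  refine ⟨a', ?_, fun e => rfl, ?_, ?_⟩
  · rintro (e | k)
    · exact Or.inl ⟨e, rfl⟩
    · induction k using Fin.lastCases with
      | last => rwa [ha'l]
      | cast j => rw [ha'c]; exact ha _
  · have hincl : {G | ∃ u, P'.value (graphInput G) u = false ∧ Accepts (a' u) G} ⊆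
        {G | ∃ u, P.value (graphInput G) u = false ∧ Accepts (a u) G} ∪
          {G | Accepts 𝓖 G ∧ ¬ Accepts 𝓕 G} := by
      rintro G ⟨u, hu, hacc⟩
      by_cases hbad : ∃ u, P.value (graphInput G) u = false ∧ Accepts (a u) G
      · exact Or.inl hbad
      · right
        rcases u with e | k
        · refine absurd ⟨Sum.inl e, ?_, ?_⟩ hbad
          · rwa [Gates.value_inl] at hu ⊢
          · rw [hin]; exact hacc
        · induction k using Fin.lastCases with
          | last =>
            rw [ha'l] at hacc
            refine ⟨hacc, fun hF => ?_⟩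
            rw [hval₀ G (fun u hu' => ?_) hF] at hu
            · cases hu
            · by_contra hv
              exact hbad ⟨u, by simpa using hv, hu'⟩
          | cast j =>
            rw [ha'c] at hacc
            rw [hP'] at hu
            exact absurd ⟨_, hu, hacc⟩ hbad
    calc _ ≤ _ := measureReal_mono hincl
      _ ≤ _ := measureReal_union_le _ _
      _ ≤ s * e₀ + e₀ := add_le_add hneg h₀
      _ = ((s + 1 : ℕ) : ℝ) * e₀ := by push_cast; ring
  · have hincl : {G | (∃ B, G = isolatedClique B) ∧
          ∃ u, P'.value (graphInput G) u = true ∧ ¬ Accepts (a' u) G} ⊆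
        {G | (∃ B, G = isolatedClique B) ∧
          ∃ u, P.value (graphInput G) u = true ∧ ¬ Accepts (a u) G} ∪
          {G | Accepts 𝓕 G ∧ ¬ Accepts 𝓖 G} := by
      rintro G ⟨⟨B, rfl⟩, u, hu, hacc⟩
      by_cases hbad : ∃ u, P.value (graphInput (isolatedClique B)) u = true ∧
          ¬ Accepts (a u) (isolatedClique B)
      · exact Or.inl ⟨⟨B, rfl⟩, hbad⟩
      · right
        rcases u with e | k
        · refine absurd ⟨Sum.inl e, ?_, ?_⟩ hbad
          · rwa [Gates.value_inl] at hu ⊢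
          · rw [hin]; exact hacc
        · induction k using Fin.lastCases with
          | last =>
            rw [ha'l] at hacc
            refine ⟨hval₁ B (fun u hu' => ?_) hu, hacc⟩
            by_contra hv
            exact hbad ⟨u, hu', hv⟩
          | cast j =>
            rw [ha'c] at hacc
            rw [hP'] at hu
            exact absurd ⟨_, hu, hacc⟩ hbad
    calc _ ≤ _ := measureReal_mono hincl
      _ ≤ _ := measureReal_union_le _ _
      _ ≤ s * e₁ + e₁ := add_le_add hpos h₁
      _ = ((s + 1 : ℕ) : ℝ) * e₁ := by push_cast; ring

/-- An `∨`-gate is approximated by the union of two families, and an `∧`-gate by the family of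
pairwise unions, which is exact on isolated cliques. -/
lemma Gates.approximable [IsFiniteMeasure μ] [IsFiniteMeasure ν] (hε : 0 ≤ ε)
    (hh : 2 ≤ h) (hsun : HasCliqueSunflowers μ ε (2 * h) r) (hr : 0 ≤ r) (hb : 0 ≤ b)
    (hrb : r * b ≤ 1 / 2)
    (hν : ∀ A : Finset (Fin n), 2 ≤ #A → ν.real {G | isolatedClique A ≤ G} ≤ b ^ #A)
    {s : ℕ} (P : Gates (VertexPair n) s) :
    P.Approximable μ ν ε h (#({A | #A ≤ 2 * h} : Finset (Finset (Fin n))) * ε)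
      (2 * (r * b) ^ (h + 1)) := by
  induction P with
  | nil =>
    refine ⟨Sum.elim (fun e => {e.1.toFinset}) (fun k => k.elim0), ?_, fun e => rfl, ?_, ?_⟩
    · rintro (e | k)
      · exact Or.inl ⟨e, rfl⟩
      · exact k.elim0
    · have : {G : SimpleGraph (Fin n) | ∃ u, Gates.nil.value (graphInput G) u = false ∧
          Accepts (Sum.elim (fun e => {e.1.toFinset}) (fun k : Fin 0 => k.elim0) u) G} = ∅ := by
        refine Set.eq_empty_of_forall_notMem ?_
        rintro G ⟨e | k, hv, hacc⟩
        · rw [Gates.value_inl] at hv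
          rw [Sum.elim_inl, accepts_edge_iff, hv] at hacc
          cases hacc
        · exact k.elim0
      rw [this]; simp
    · have : {G : SimpleGraph (Fin n) | (∃ B, G = isolatedClique B) ∧
          ∃ u, Gates.nil.value (graphInput G) u = true ∧
          ¬ Accepts (Sum.elim (fun e => {e.1.toFinset}) (fun k : Fin 0 => k.elim0) u) G} = ∅ := by
        refine Set.eq_empty_of_forall_notMem ?_
        rintro G ⟨-, e | k, hv, hacc⟩
        · rw [Gates.value_inl] at hv
          exact hacc ((accepts_edge_iff e G).2 hv)
        · exact k.elim0
      rw [this]; simp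
  | @and s P u v ih =>
    obtain ⟨a, ha, hin, hneg, hpos⟩ := ih
    obtain ⟨𝓖, h𝓖, h₀, h₁⟩ := exists_isApproximator
      (𝓕 := ((a u) ×ˢ (a v)).image fun AB => AB.1 ∪ AB.2) hε hh hsun hr hb hrb hν (by
        intro A hA
        obtain ⟨⟨A₁, A₂⟩, hA', rfl⟩ := mem_image.1 hA
        rw [mem_product] at hA'
        have e1 := (ha u).card_le hh _ hA'.1
        have e2 := (ha v).card_le hh _ hA'.2
        have e3 := card_union_le A₁ A₂
        dsimp only at e1 e2 ⊢
        omega)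
    refine Gates.approximable_succ (P := P) (fun x j => by simp [Gates.value]) ha hin hneg hpos
      h𝓖 h₀ h₁ ?_ ?_
    · rintro G hG ⟨A, hA, hAG⟩
      obtain ⟨⟨A₁, A₂⟩, hA', rfl⟩ := mem_image.1 hA
      rw [mem_product] at hA'
      have e1 := hG u ⟨A₁, hA'.1, (isolatedClique_mono subset_union_left).trans hAG⟩
      have e2 := hG v ⟨A₂, hA'.2, (isolatedClique_mono subset_union_right).trans hAG⟩
      simp [Gates.value, e1, e2]
    · intro B hB hval
      simp only [Gates.value, Fin.lastCases_last, Bool.and_eq_true] at hval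
      obtain ⟨A₁, hA₁, hB₁⟩ := (ha u).exists_subset hε (hB u hval.1)
      obtain ⟨A₂, hA₂, hB₂⟩ := (ha v).exists_subset hε (hB v hval.2)
      exact ⟨A₁ ∪ A₂, mem_image.2 ⟨(A₁, A₂), mem_product.2 ⟨hA₁, hA₂⟩, rfl⟩,
        isolatedClique_mono (union_subset hB₁ hB₂)⟩
  | @or s P u v ih =>
    obtain ⟨a, ha, hin, hneg, hpos⟩ := ih
    obtain ⟨𝓖, h𝓖, h₀, h₁⟩ := exists_isApproximator
      (𝓕 := a u ∪ a v) hε hh hsun hr hb hrb hν (by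
        intro A hA
        rcases mem_union.1 hA with hA | hA
        · have := (ha u).card_le hh _ hA
          omega
        · have := (ha v).card_le hh _ hA
          omega)
    refine Gates.approximable_succ (P := P) (fun x j => by simp [Gates.value]) ha hin hneg hpos
      h𝓖 h₀ h₁ ?_ ?_
    · rintro G hG ⟨A, hA, hAG⟩
      simp only [Gates.value, Fin.lastCases_last, Bool.or_eq_true]
      rcases mem_union.1 hA with hA | hA
      · exact Or.inl (hG u ⟨A, hA, hAG⟩)
      · exact Or.inr (hG v ⟨A, hA, hAG⟩)
    · intro B hB hval
      simp only [Gates.value, Fin.lastCases_last, Bool.or_eq_true] at hval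
      rcases hval with hval | hval
      · exact (hB u hval).mono subset_union_left
      · exact (hB v hval).mono subset_union_right

/-- The approximator of the output either accepts every graph, so that all the rejected graphs are
negative errors, or it rarely accepts an isolated clique, so that many of the accepted cliques are
positive errors. -/
lemma MonotoneCircuit.size_bound_of_sunflowers [IsFiniteMeasure μ] [IsFiniteMeasure ν]
    (hε : 0 ≤ ε) (hh : 2 ≤ h) (hsun : HasCliqueSunflowers μ ε (2 * h) r) (hr : 0 ≤ r) (hb : 0 ≤ b)
    (hb2 : b ≤ 1 / 2) (hrb : r * b ≤ 1 / 4)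
    (hν : ∀ A : Finset (Fin n), 2 ≤ #A → ν.real {G | isolatedClique A ≤ G} ≤ b ^ #A)
    (hsupp : ν.real {G | ¬ ∃ B, G = isolatedClique B} = 0)
    (C : MonotoneCircuit (VertexPair n))
    (hC₀ : 2 / 3 ≤ μ.real {G | C.eval (graphInput G) = false})
    (hC₁ : 2 / 3 ≤ ν.real {G | C.eval (graphInput G) = true}) :
    2 / 3 ≤ C.size * (#({A | #A ≤ 2 * h} : Finset (Finset (Fin n))) * ε) ∨
      1 / 3 ≤ C.size * (2 * (r * b) ^ (h + 1)) := by
  obtain ⟨a, ha, -, hneg, hpos⟩ :=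
    C.gates.approximable (μ := μ) hε hh hsun hr hb (by linarith) hν
  by_cases hsmall : ∃ A ∈ a C.output, #A ≤ 1
  · left
    obtain ⟨A, hA, hA1⟩ := hsmall
    refine (hC₀.trans (measureReal_mono fun G hG => ?_)).trans hneg
    exact ⟨C.output, hG, A, hA, isolatedClique_le_of_card_le_one hA1 G⟩
  · right
    push Not at hsmall
    have hacc : ν.real {G | Accepts (a C.output) G} ≤ 1 / 3 := by
      rcases ha C.output with ⟨e, he⟩ | ⟨𝓗, h𝓗, he⟩
      · have h1 := hν e.1.toFinset (card_edge e).ge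
        rw [card_edge] at h1
        have h2 : {G : SimpleGraph (Fin n) | Accepts (a C.output) G} =
            {G | isolatedClique e.1.toFinset ≤ G} := by
          rw [he]; simp [Accepts]
        rw [h2]
        nlinarith
      · have h1 := h𝓗.measureReal_minimal_le hsun hr hb (by linarith) hν (a := 2) le_rfl
        refine (measureReal_mono fun G hG => ?_).trans (h1.trans ?_)
        · have hG' : Accepts 𝓗 G := by
            rw [Set.mem_ofPred_eq, he] at hG
            exact hG.mono (filter_subset _ _)
          obtain ⟨A₀, hA₀, hA₀G⟩ := hG
          rw [he] at hA₀ hsmall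
          obtain ⟨A, hA, hmin, hAG⟩ := exists_minimal_of_accepts hG'
          refine ⟨A, hA, hmin, ?_, hAG⟩
          by_contra hlt
          exact absurd (hsmall A (mem_filter.2 ⟨hA, by omega⟩)) (by omega)
        · nlinarith [mul_nonneg hr hb]
    have hincl : {G | C.eval (graphInput G) = true} ⊆
        ({G | (∃ B, G = isolatedClique B) ∧
          ∃ u, C.gates.value (graphInput G) u = true ∧ ¬ Accepts (a u) G} ∪
        {G | Accepts (a C.output) G}) ∪ {G | ¬ ∃ B, G = isolatedClique B} := by
      intro G hG
      by_cases h1 : ∃ B, G = isolatedClique B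
      · left
        by_cases h2 : Accepts (a C.output) G
        · exact Or.inr h2
        · exact Or.inl ⟨h1, C.output, hG, h2⟩
      · exact Or.inr h1
    have h1 := (measureReal_mono (μ := ν) hincl).trans (measureReal_union_le _ _)
    have h2 := measureReal_union_le (μ := ν) {G | (∃ B, G = isolatedClique B) ∧
          ∃ u, C.gates.value (graphInput G) u = true ∧ ¬ Accepts (a u) G}
        {G | Accepts (a C.output) G}
    linarith

end Circuits

/-! ### Uniformly random isolated cliques -/

section PositiveDistribution

open Finset
open scoped Classical

variable {n β : ℕ}

lemma choose_sub_mul_pow_le (hβ : β ≤ n) {m : ℕ} (hm : m ≤ β) :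
    (n - m).choose (β - m) * n ^ m ≤ n.choose β * β ^ m := by
  induction m with
  | zero => simp
  | succ m ih =>
    have h1 := ih (by omega)
    obtain ⟨k, rfl⟩ : ∃ k, β = m + 1 + k := ⟨β - (m + 1), by omega⟩
    obtain ⟨l, rfl⟩ : ∃ l, n = m + 1 + l := ⟨n - (m + 1), by omega⟩
    have hkl : k ≤ l := by omega
    have e1 : m + 1 + l - m = l + 1 := by omega
    have e2 : m + 1 + k - m = k + 1 := by omega
    rw [e1, e2] at h1
    rw [Nat.add_sub_cancel_left, Nat.add_sub_cancel_left]
    have h2 := Nat.add_one_mul_choose_eq l k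
    have h3 : (k + 1) * (m + 1 + l) ≤ (m + 1 + k) * (l + 1) := by nlinarith
    refine Nat.le_of_mul_le_mul_left ?_ (Nat.succ_pos l)
    calc (l + 1) * (l.choose k * (m + 1 + l) ^ (m + 1))
        = (l + 1) * l.choose k * (m + 1 + l) * (m + 1 + l) ^ m := by rw [pow_succ]; ring
      _ = (l + 1).choose (k + 1) * (m + 1 + l) ^ m * ((k + 1) * (m + 1 + l)) := by
          rw [h2]; ring
      _ ≤ (m + 1 + l).choose (m + 1 + k) * (m + 1 + k) ^ m * ((m + 1 + k) * (l + 1)) :=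
          Nat.mul_le_mul h1 h3
      _ = (l + 1) * ((m + 1 + l).choose (m + 1 + k) * (m + 1 + k) ^ (m + 1)) := by
          rw [pow_succ]; ring

lemma card_powersetCard_superset_mul_pow_le (hβ : β ≤ n) (A : Finset (Fin n)) :
    #{B ∈ powersetCard β univ | A ⊆ B} * n ^ #A ≤ n.choose β * β ^ #A := by
  by_cases hA : #A ≤ β
  · refine le_trans (Nat.mul_le_mul_right _ ?_) (choose_sub_mul_pow_le hβ hA)
    calc #{B ∈ powersetCard β univ | A ⊆ B} ≤ #(powersetCard (β - #A) (univ \ A)) := by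
          refine card_le_card_of_injOn (fun B => B \ A) ?_ ?_
          · intro B hB
            simp only [coe_filter, mem_powersetCard, Set.mem_ofPred_eq] at hB
            rw [mem_coe, mem_powersetCard]
            exact ⟨sdiff_subset_sdiff (subset_univ _) Subset.rfl,
              by rw [card_sdiff_of_subset hB.2, hB.1.2]⟩
          · intro B hB B' hB' heq
            simp only [coe_filter, mem_powersetCard, Set.mem_ofPred_eq] at hB hB'
            dsimp only at heq
            rw [← sdiff_union_of_subset hB.2, heq, sdiff_union_of_subset hB'.2]
      _ = (n - #A).choose (β - #A) := by
          rw [card_powersetCard, card_sdiff_of_subset (subset_univ _), card_univ, Fintype.card_fin]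
  · have : ({B ∈ powersetCard β univ | A ⊆ B} : Finset (Finset (Fin n))) = ∅ := by
      refine filter_eq_empty_iff.2 fun B hB hAB => hA ?_
      rw [← (mem_powersetCard.1 hB).2]
      exact card_le_card hAB
    rw [this]
    simp

lemma setOf_isolatedClique_eq (n β : ℕ) :
    {G | ∃ A : Finset (Fin n), #A = β ∧ G = isolatedClique A} =
      (((powersetCard β univ).image isolatedClique : Finset (SimpleGraph (Fin n))) : Set _) := by
  ext G
  simp [mem_powersetCard, eq_comm]

lemma isProbabilityMeasure_positiveDist (hβ : β ≤ n) : IsProbabilityMeasure (positiveDist n β) := by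
  unfold positiveDist
  rw [setOf_isolatedClique_eq]
  refine isProbabilityMeasure_uniformOn (Finset.finite_toSet _) ?_
  rw [coe_nonempty, image_nonempty, powersetCard_nonempty]
  simpa using hβ

lemma positiveDist_real_not_isolatedClique (n β : ℕ) :
    (positiveDist n β).real {G | ¬ ∃ B, G = isolatedClique B} = 0 := by
  have h : positiveDist n β {G | ¬ ∃ B, G = isolatedClique B} = 0 := by
    unfold positiveDist
    rw [uniformOn_eq_zero_iff (Set.toFinite _)]
    refine Set.eq_empty_of_forall_notMem ?_
    rintro G ⟨⟨A, -, rfl⟩, hG⟩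
    exact hG ⟨A, rfl⟩
  rw [measureReal_def, h, ENNReal.toReal_zero]

lemma positiveDist_real_isolatedClique_le (hβ2 : 2 ≤ β) (hβ : β ≤ n) (A : Finset (Fin n))
    (hA : 2 ≤ #A) :
    (positiveDist n β).real {G | isolatedClique A ≤ G} ≤ ((β : ℝ) / n) ^ #A := by
  have hinj : Set.InjOn isolatedClique
      (powersetCard β (univ : Finset (Fin n)) : Set (Finset (Fin n))) := by
    intro B hB B' hB' heq
    have h1 := (mem_powersetCard.1 (mem_coe.1 hB)).2
    have h2 := (mem_powersetCard.1 (mem_coe.1 hB')).2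
    exact (subset_of_isolatedClique_le (by omega) heq.le).antisymm
      (subset_of_isolatedClique_le (by omega) heq.ge)
  have hset : ({G | isolatedClique A ≤ G} : Set (SimpleGraph (Fin n))) =
      (({G | isolatedClique A ≤ G} : Finset (SimpleGraph (Fin n))) : Set _) := by
    ext; simp
  have hcard : #((powersetCard β (univ : Finset (Fin n))).image isolatedClique) = n.choose β := by
    rw [card_image_of_injOn hinj, card_powersetCard, card_univ, Fintype.card_fin]
  have hle : #((powersetCard β (univ : Finset (Fin n))).image isolatedClique ∩
      ({G | isolatedClique A ≤ G} : Finset (SimpleGraph (Fin n)))) ≤ #{B ∈ powersetCard β (univ : Finset (Fin n)) | A ⊆ B} := by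
    refine le_trans (card_le_card ?_) (card_image_le (f := isolatedClique))
    intro G hG
    rw [mem_inter, mem_image, mem_filter] at hG
    obtain ⟨⟨B, hB, rfl⟩, -, hAB⟩ := hG
    exact mem_image.2 ⟨B, mem_filter.2 ⟨hB, subset_of_isolatedClique_le hA hAB⟩, rfl⟩
  have hn : (0 : ℝ) < n := by
    have : 0 < n := by omega
    exact_mod_cast this
  have hch : (0 : ℝ) < n.choose β := by exact_mod_cast Nat.choose_pos hβ
  unfold positiveDist
  rw [setOf_isolatedClique_eq, hset, measureReal_def, uniformOn_apply_finset, hcard,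
    ENNReal.toReal_div, ENNReal.toReal_natCast, ENNReal.toReal_natCast, div_pow,
    div_le_div_iff₀ hch (pow_pos hn _)]
  calc _ ≤ (#{B ∈ powersetCard β (univ : Finset (Fin n)) | A ⊆ B} : ℝ) * n ^ #A :=
        mul_le_mul_of_nonneg_right (by exact_mod_cast hle) (by positivity)
    _ ≤ n.choose β * β ^ #A := by exact_mod_cast card_powersetCard_superset_mul_pow_le hβ A
    _ = _ := mul_comm _ _

end PositiveDistribution

/-! ### Circuits that read few inputs -/

section FewInputs

open Finset
open scoped Classical

lemma Gates.exists_inputs {ι : Type} {s : ℕ} (P : Gates ι s) :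
    ∃ D : Finset ι, #D ≤ 2 * s ∧
      ∀ x : ι → Bool, (∀ i ∈ D, x i = false) → ∀ k, P.value x (Sum.inr k) = false := by
  have wire : ∀ {s : ℕ} (u : ι ⊕ Fin s), ∃ E : Finset ι, #E ≤ 1 ∧ ∀ i, u = Sum.inl i → i ∈ E := by
    rintro s (i | k)
    · exact ⟨{i}, by simp, fun j hj => by simpa using (Sum.inl.inj hj).symm⟩
    · exact ⟨∅, by simp, fun j hj => by cases hj⟩
  have step : ∀ {s : ℕ} (P : Gates ι s) (u v : ι ⊕ Fin s) (D : Finset ι), #D ≤ 2 * s →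
      (∀ x : ι → Bool, (∀ i ∈ D, x i = false) → ∀ k, P.value x (Sum.inr k) = false) →
      ∃ D' : Finset ι, #D' ≤ 2 * (s + 1) ∧ ∀ x : ι → Bool, (∀ i ∈ D', x i = false) →
        P.value x u = false ∧ P.value x v = false ∧ ∀ k, P.value x (Sum.inr k) = false := by
    intro s P u v D hD hval
    obtain ⟨E, hE, hEu⟩ := wire u
    obtain ⟨F, hF, hFv⟩ := wire v
    refine ⟨D ∪ (E ∪ F), ?_, fun x hx => ?_⟩
    · have h1 := card_union_le D (E ∪ F)
      have h2 := card_union_le E F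
      omega
    · have hD := hval x fun i hi => hx i (mem_union_left _ hi)
      refine ⟨?_, ?_, hD⟩
      · rcases u with i | k
        · rw [Gates.value_inl]
          exact hx i (mem_union_right _ (mem_union_left _ (hEu i rfl)))
        · exact hD k
      · rcases v with i | k
        · rw [Gates.value_inl]
          exact hx i (mem_union_right _ (mem_union_right _ (hFv i rfl)))
        · exact hD k
  induction P with
  | nil => exact ⟨∅, by simp, fun x _ k => k.elim0⟩
  | @and s P u v ih =>
    obtain ⟨D, hD, hval⟩ := ih
    obtain ⟨D', hD', hval'⟩ := step P u v D hD hval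
    refine ⟨D', hD', fun x hx k => ?_⟩
    obtain ⟨h1, -, h3⟩ := hval' x hx
    induction k using Fin.lastCases with
    | last => simp [Gates.value, h1]
    | cast j => simp [Gates.value, h3]
  | @or s P u v ih =>
    obtain ⟨D, hD, hval⟩ := ih
    obtain ⟨D', hD', hval'⟩ := step P u v D hD hval
    refine ⟨D', hD', fun x hx k => ?_⟩
    obtain ⟨h1, h2, h3⟩ := hval' x hx
    induction k using Fin.lastCases with
    | last => simp [Gates.value, h1, h2]
    | cast j => simp [Gates.value, h3]

/-- A circuit of size `s` reads at most `2 * s + 1` input variables, and it cannot accept a graph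
without any of these edges. -/
lemma MonotoneCircuit.size_bound_of_inputs {n : ℕ} {ν : Measure (SimpleGraph (Fin n))}
    [IsFiniteMeasure ν] {b : ℝ}
    (hν : ∀ A : Finset (Fin n), 2 ≤ #A → ν.real {G | isolatedClique A ≤ G} ≤ b ^ #A)
    (C : MonotoneCircuit (VertexPair n))
    (hC₁ : 2 / 3 ≤ ν.real {G | C.eval (graphInput G) = true}) :
    2 / 3 ≤ (2 * C.size + 1) * b ^ 2 := by
  obtain ⟨D, hD, hval⟩ := C.gates.exists_inputs
  obtain ⟨D', hD', hval'⟩ : ∃ D' : Finset (VertexPair n), #D' ≤ 2 * C.size + 1 ∧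
      ∀ x, (∀ i ∈ D', x i = false) → C.eval x = false := by
    unfold MonotoneCircuit.eval
    rcases C.output with e | k
    · refine ⟨{e}, by simp, fun x hx => ?_⟩
      rw [Gates.value_inl]
      exact hx e (mem_singleton_self e)
    · exact ⟨D, by omega, fun x hx => hval x hx k⟩
  have hincl : {G | C.eval (graphInput G) = true} ⊆
      ⋃ e ∈ D', {G | isolatedClique e.1.toFinset ≤ G} := by
    intro G hG
    by_contra hno
    simp only [Set.mem_iUnion, not_exists, Set.mem_ofPred_eq] at hno hG
    rw [hval' _ fun e he => ?_] at hG
    · cases hG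
    · have := hno e he
      by_contra ht
      have hacc := (accepts_edge_iff e G).2 (by simpa using ht)
      obtain ⟨A, hA, hAG⟩ := hacc
      rw [mem_singleton.1 hA] at hAG
      exact this hAG
  have hD'' : (#D' : ℝ) ≤ 2 * C.size + 1 := by exact_mod_cast hD'
  calc (2 : ℝ) / 3 ≤ _ := hC₁
    _ ≤ _ := measureReal_mono hincl (measure_ne_top _ _)
    _ ≤ ∑ e ∈ D', ν.real {G | isolatedClique e.1.toFinset ≤ G} := measureReal_biUnion_finset_le _ _
    _ ≤ ∑ e ∈ D', b ^ 2 := by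
        refine sum_le_sum fun e _ => ?_
        have := hν e.1.toFinset (card_edge e).ge
        rwa [card_edge] at this
    _ = #D' * b ^ 2 := by rw [sum_const, nsmul_eq_mul]
    _ ≤ _ := mul_le_mul_of_nonneg_right hD'' (sq_nonneg b)

end FewInputs

/-! ### Choice of the parameters -/

section Parameters

open Finset
open scoped Classical

lemma card_finset_card_le (n ℓ : ℕ) :
    #({A | #A ≤ ℓ} : Finset (Finset (Fin n))) ≤ (n + 1) ^ ℓ := by
  have hsub : ({A | #A ≤ ℓ} : Finset (Finset (Fin n))) ⊆
      (range (ℓ + 1)).biUnion fun i => powersetCard i univ := by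
    intro A hA
    rw [mem_filter] at hA
    exact mem_biUnion.2 ⟨#A, mem_range.2 (Nat.lt_succ_of_le hA.2),
      mem_powersetCard.2 ⟨subset_univ _, rfl⟩⟩
  calc _ ≤ _ := card_le_card hsub
    _ ≤ ∑ i ∈ range (ℓ + 1), #(powersetCard i (univ : Finset (Fin n))) := card_biUnion_le
    _ ≤ ∑ i ∈ range (ℓ + 1), n ^ i * 1 ^ (ℓ - i) * ℓ.choose i := by
        refine sum_le_sum fun i hi => ?_
        rw [card_powersetCard, card_univ, Fintype.card_fin, one_pow, mul_one]
        calc n.choose i ≤ n ^ i := Nat.choose_le_pow n i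
          _ ≤ n ^ i * ℓ.choose i :=
            Nat.le_mul_of_pos_right _ (Nat.choose_pos (Nat.lt_succ_iff.1 (mem_range.1 hi)))
    _ = (n + 1) ^ ℓ := (add_pow n 1 ℓ).symm

/-- What the bound on `α * β` says about the size of the parameters. -/
lemma parameter_bounds {n α β : ℕ} {δ : ℝ} (hα : 2 ≤ α) (hαβ : α ≤ β) (hδ : 0 < δ)
    (h : (α : ℝ) * β < (n : ℝ) ^ (1 - δ) / Real.log n) :
    5 ≤ n ∧ 3 / 2 ≤ Real.log n ∧ δ < 1 ∧
      (α : ℝ) * β * Real.log n < n * Real.exp (-(δ * Real.log n)) := by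
  have hα' : (2 : ℝ) ≤ α := by exact_mod_cast hα
  have hβ' : (2 : ℝ) ≤ β := by exact_mod_cast hα.trans hαβ
  have h4 : (4 : ℝ) ≤ α * β := by nlinarith
  have hn2 : 2 ≤ n := by
    by_contra hlt
    have h01 : n = 0 ∨ n = 1 := by omega
    have : Real.log n = 0 := by rcases h01 with rfl | rfl <;> simp
    rw [this, div_zero] at h
    linarith
  have hn2' : (2 : ℝ) ≤ n := by exact_mod_cast hn2
  have hlog2 : Real.log 2 ≤ Real.log n := Real.log_le_log (by norm_num) hn2'
  have hL : 0 < Real.log n := by have := Real.log_two_gt_d9; linarith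
  rw [lt_div_iff₀ hL] at h
  have hpow : (n : ℝ) ^ (1 - δ) ≤ n := by
    calc (n : ℝ) ^ (1 - δ) ≤ (n : ℝ) ^ (1 : ℝ) :=
          Real.rpow_le_rpow_of_exponent_le (by linarith) (by linarith)
      _ = n := Real.rpow_one _
  have h4L : 4 * Real.log n ≤ α * β * Real.log n := mul_le_mul_of_nonneg_right h4 hL.le
  have hn3 : 3 ≤ n := by
    have h1 : (2 : ℝ) < n := by have := Real.log_two_gt_d9; linarith
    exact_mod_cast h1
  have hn3' : (3 : ℝ) ≤ n := by exact_mod_cast hn3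
  have hL1 : 1 ≤ Real.log n := by
    rw [Real.le_log_iff_exp_le (by linarith)]
    have := Real.exp_one_lt_d9
    linarith
  have hn5 : 5 ≤ n := by
    have h1 : (4 : ℝ) < n := by linarith
    have : 4 < n := by exact_mod_cast h1
    omega
  have hn5' : (5 : ℝ) ≤ n := by exact_mod_cast hn5
  have hL32 : 3 / 2 ≤ Real.log n := by
    rw [Real.le_log_iff_exp_le (by linarith)]
    have h1 : Real.exp (3 / 2) ^ 2 = Real.exp 1 ^ 3 := by
      rw [← Real.exp_nat_mul, ← Real.exp_nat_mul]; norm_num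
    have h2 : Real.exp 1 ^ 3 ≤ 2.72 ^ 3 :=
      pow_le_pow_left₀ (Real.exp_pos _).le (by have := Real.exp_one_lt_d9; linarith) 3
    have h3 : Real.exp (3 / 2) ≤ 5 :=
      le_of_sq_le_sq (by rw [h1]; exact h2.trans (by norm_num)) (by norm_num)
    linarith
  refine ⟨hn5, hL32, ?_, ?_⟩
  · by_contra! hδ1
    have := Real.rpow_le_one_of_one_le_of_nonpos (x := (n : ℝ)) (z := 1 - δ) (by linarith)
      (by linarith)
    linarith
  · refine h.trans_eq ?_
    rw [Real.rpow_sub (by linarith), Real.rpow_one, Real.rpow_def_of_pos (by linarith),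
      Real.exp_neg, div_eq_mul_inv, mul_comm δ]

lemma hasCliqueSunflowers_negativeDist {n α ℓ N j : ℕ} (hp : 0 < (edgeProb n α : ℝ)) (hN : 0 < N)
    (hj : 0 < j) (hℓ : ℓ < 2 ^ j) :
    HasCliqueSunflowers (negativeDist n α) ((1 / 3) ^ N) ℓ
      (16 * N * j / (edgeProb n α : ℝ) ^ ℓ) :=
  fun _ hm 𝒮 h𝒮 hcard => exists_clique_sunflower hp hN hj hℓ hm 𝒮 h𝒮 hcard

/-- With `ε = 3 ^ (-N)` and `N ≥ 3 * ℓ * log n`, closing a family is cheap. -/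
lemma card_mul_pow_le {n ℓ N : ℕ} (hn : 2 ≤ n) (hN : 3 * ℓ * Real.log n ≤ N) :
    (#({A | #A ≤ ℓ} : Finset (Finset (Fin n))) : ℝ) * (1 / 3) ^ N ≤
      Real.exp (-(ℓ * Real.log n)) := by
  have hn0 : (0 : ℝ) < n := by
    have : 0 < n := by omega
    exact_mod_cast this
  have h1 : (#({A | #A ≤ ℓ} : Finset (Finset (Fin n))) : ℝ) ≤ Real.exp (2 * ℓ * Real.log n) := by
    have h2 : (#({A | #A ≤ ℓ} : Finset (Finset (Fin n)))) ≤ n ^ (2 * ℓ) := by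
      refine (card_finset_card_le n ℓ).trans ?_
      rw [pow_mul]
      exact Nat.pow_le_pow_left (by nlinarith) ℓ
    calc (#({A | #A ≤ ℓ} : Finset (Finset (Fin n))) : ℝ) ≤ (n : ℝ) ^ (2 * ℓ) := by
          exact_mod_cast h2
      _ = Real.exp (2 * ℓ * Real.log n) := by
          conv_lhs => rw [← Real.exp_log hn0]
          rw [← Real.exp_nat_mul]
          push_cast
          rfl
  have h3 : (1 / 3 : ℝ) ^ N ≤ Real.exp (-(3 * ℓ * Real.log n)) := by
    calc (1 / 3 : ℝ) ^ N ≤ (Real.exp (-1)) ^ N := by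
          refine pow_le_pow_left₀ (by norm_num) ?_ N
          rw [Real.exp_neg, one_div]
          exact inv_anti₀ (Real.exp_pos 1) (by have := Real.exp_one_lt_d9; linarith)
      _ = Real.exp (-N) := by rw [← Real.exp_nat_mul]; ring_nf
      _ ≤ _ := Real.exp_le_exp.2 (by linarith)
  calc _ ≤ Real.exp (2 * ℓ * Real.log n) * Real.exp (-(3 * ℓ * Real.log n)) :=
        mul_le_mul h1 h3 (by positivity) (Real.exp_pos _).le
    _ = _ := by rw [← Real.exp_add]; ring_nf

/-- The spreadness that clique sunflowers need is small compared to `n / β`.  Here `t = δ * log n`: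
the bound on `α * β` provides the factor `exp (-t)`, and `t` itself, which enters through the size
of the sets, is absorbed in it. -/
lemma spreadness_mul_ratio_le {n α β h N j : ℕ} {δ : ℝ} (hn : 1 ≤ n) (hα : 2 ≤ α) (hδ : 0 < δ)
    (hL : 0 ≤ Real.log n) (hmain : (α : ℝ) * β * Real.log n < n * Real.exp (-(δ * Real.log n)))
    (hhle : (h : ℝ) ≤ 1 / 8192 * δ * α) (hNle : (N : ℝ) ≤ 8 * h * Real.log n)
    (hjle : (j : ℝ) ≤ 3 * Real.log n) :
    16 * N * j / (edgeProb n α : ℝ) ^ (2 * h) * ((β : ℝ) / n) ≤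
      1 / 4 * Real.exp (-(δ * Real.log n) / 2) := by
  have hα' : (2 : ℝ) ≤ α := by exact_mod_cast hα
  have hn0 : (0 : ℝ) < n := by exact_mod_cast hn
  set L := Real.log n with hLdef
  set t := δ * L with ht
  have ht0 : 0 ≤ t := mul_nonneg hδ.le hL
  have hp : (edgeProb n α : ℝ) = Real.exp (L * (-2 / ((α : ℝ) - 1))) := by
    rw [coe_edgeProb hn hα, Real.rpow_def_of_pos hn0]
  have hpℓ : ((edgeProb n α : ℝ) ^ (2 * h))⁻¹ ≤ Real.exp (t / 8) := by
    rw [hp, ← Real.exp_nat_mul, ← Real.exp_neg]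
    refine Real.exp_le_exp.2 ?_
    have hα1 : (0 : ℝ) < α - 1 := by linarith
    have e1 : -(((2 * h : ℕ) : ℝ) * (L * (-2 / ((α : ℝ) - 1)))) = 4 * h * L / (α - 1) := by
      push_cast
      ring
    rw [e1, div_le_iff₀ hα1]
    have h1 : h * L ≤ 1 / 8192 * (t * α) := by
      calc h * L ≤ 1 / 8192 * δ * α * L := mul_le_mul_of_nonneg_right hhle hL
        _ = _ := by rw [ht]; ring
    have h2 : t * 2 ≤ t * α := mul_le_mul_of_nonneg_left hα' ht0
    linarith
  have h1 : (N : ℝ) * j ≤ 24 * (h * L * L) := by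
    calc (N : ℝ) * j ≤ (8 * h * L) * (3 * L) :=
          mul_le_mul hNle hjle (by positivity) (by positivity)
      _ = _ := by ring
  have h2 : h * L * L ≤ 1 / 8192 * (t * (α * L)) := by
    calc h * L * L ≤ 1 / 8192 * δ * α * L * L := by gcongr
      _ = _ := by rw [ht]; ring
  have h3 : (α : ℝ) * L * (β / n) ≤ Real.exp (-t) := by
    rw [← mul_div_assoc, div_le_iff₀ hn0]
    linarith
  -- `t = 4 * (t / 4) ≤ 4 * exp (t / 4)` absorbs the factor `δ * log n`
  have h4 : t ≤ 4 * Real.exp (t / 4) := by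
    have := Real.add_one_le_exp (t / 4)
    linarith
  calc 16 * N * j / (edgeProb n α : ℝ) ^ (2 * h) * ((β : ℝ) / n)
        = 16 * (N * j) * ((edgeProb n α : ℝ) ^ (2 * h))⁻¹ * (β / n) := by
        rw [div_eq_mul_inv]; ring
    _ ≤ 16 * (24 * (1 / 8192 * (t * (α * L)))) * Real.exp (t / 8) * (β / n) := by
        have hp' : 0 ≤ ((edgeProb n α : ℝ) ^ (2 * h))⁻¹ :=
          inv_nonneg.2 (pow_nonneg (edgeProb n α).2.1 _)
        refine mul_le_mul_of_nonneg_right (mul_le_mul (by linarith) hpℓ hp' ?_) (by positivity)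
        positivity
    _ = 16 * 24 / 8192 * t * Real.exp (t / 8) * (α * L * (β / n)) := by ring
    _ ≤ 16 * 24 / 8192 * (4 * Real.exp (t / 4)) * Real.exp (t / 8) * Real.exp (-t) := by
        gcongr
    _ = 3 / 16 * Real.exp (t / 4 + t / 8 + -t) := by
        rw [Real.exp_add, Real.exp_add]; ring
    _ ≤ 1 / 4 * Real.exp (-t / 2) :=
        mul_le_mul (by norm_num) (Real.exp_le_exp.2 (by linarith)) (Real.exp_pos _).le
          (by norm_num)

lemma exp_le_of_two_thirds_le {s b t : ℝ} (ht : 0 ≤ t) (hs : 0 ≤ s) (hb0 : 0 ≤ b)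
    (hb : b ≤ Real.exp (-t) / 3) (h : 2 / 3 ≤ (2 * s + 1) * b ^ 2) : Real.exp t ≤ s := by
  have h3 : b ^ 2 ≤ (Real.exp (-t) / 3) ^ 2 := pow_le_pow_left₀ hb0 hb 2
  have h4 : (2 : ℝ) / 3 ≤ (2 * s + 1) * (Real.exp (-t) / 3) ^ 2 :=
    h.trans (mul_le_mul_of_nonneg_left h3 (by positivity))
  have h5 : Real.exp t * Real.exp (-t) = 1 := by rw [← Real.exp_add]; simp
  have h6 : 1 ≤ Real.exp t := Real.one_le_exp ht
  have h7 : 6 * Real.exp t ≤ 2 * s + 1 := by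
    have h8 : 6 * Real.exp t ^ 2 ≤ 2 * s + 1 := by
      have := mul_le_mul_of_nonneg_right h4 (by positivity : (0 : ℝ) ≤ 9 * Real.exp t ^ 2)
      calc 6 * Real.exp t ^ 2 = 2 / 3 * (9 * Real.exp t ^ 2) := by ring
        _ ≤ _ := this
        _ = (2 * s + 1) * (Real.exp t * Real.exp (-t)) ^ 2 := by ring
        _ = 2 * s + 1 := by rw [h5]; ring
    nlinarith
  linarith

lemma exp_le_of_negative_errors {s t L h : ℝ} (htL : t ≤ L) (hL : 3 / 2 ≤ L) (hh : 2 ≤ h)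
    (h2 : 2 / 3 ≤ s * Real.exp (-(2 * h * L))) : Real.exp (t * (h + 1) / 2) ≤ s := by
  rw [Real.exp_neg, ← div_eq_mul_inv, le_div_iff₀ (Real.exp_pos _)] at h2
  refine le_trans ?_ h2
  have h3 : (3 : ℝ) / 2 ≤ Real.exp 1 := by have := Real.exp_one_gt_d9; linarith
  have h4 : Real.exp 1 * Real.exp (t * (h + 1) / 2) ≤
      Real.exp (2 * h * L) := by
    rw [← Real.exp_add]
    refine Real.exp_le_exp.2 ?_
    have h6 := mul_le_mul_of_nonneg_right htL (by linarith : (0 : ℝ) ≤ h + 1)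
    have h7 := mul_le_mul_of_nonneg_right hh (by linarith : 0 ≤ L)
    linarith
  have h5 := mul_le_mul_of_nonneg_right h3 (Real.exp_pos (t * (h + 1) / 2)).le
  linarith

lemma exp_le_of_positive_errors {s x t : ℝ} {h : ℕ} (hh : 2 ≤ h) (hs : 0 ≤ s) (hx0 : 0 ≤ x)
    (hx : x ≤ 1 / 4 * Real.exp (-t / 2)) (hB : 1 / 3 ≤ s * (2 * x ^ (h + 1))) :
    Real.exp (t * (h + 1) / 2) ≤ s := by
  have h1 : x ^ (h + 1) ≤ 1 / 64 * Real.exp (-(t * (h + 1) / 2)) := by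
    calc x ^ (h + 1) ≤ (1 / 4 * Real.exp (-t / 2)) ^ (h + 1) :=
          pow_le_pow_left₀ hx0 hx _
      _ = (1 / 4) ^ (h + 1) * Real.exp (-(t * (h + 1) / 2)) := by
          rw [mul_pow, ← Real.exp_nat_mul]
          push_cast
          ring_nf
      _ ≤ _ := by
          refine mul_le_mul_of_nonneg_right ?_ (Real.exp_pos _).le
          calc (1 / 4 : ℝ) ^ (h + 1) ≤ (1 / 4) ^ 3 :=
                pow_le_pow_of_le_one (by norm_num) (by norm_num) (by omega)
            _ = 1 / 64 := by norm_num
  have h2 : 1 / 3 ≤ s * (2 * (1 / 64 * Real.exp (-(t * (h + 1) / 2)))) :=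
    hB.trans (by gcongr)
  have h3 : 1 / 3 ≤ 1 / 32 * s * Real.exp (-(t * (h + 1) / 2)) := by linarith
  rw [Real.exp_neg, ← div_eq_mul_inv, le_div_iff₀ (Real.exp_pos _)] at h3
  have := Real.exp_pos (t * (h + 1) / 2)
  linarith

end Parameters

theorem theorem1p3 :
    ∃ c : ℝ, 0 < c ∧
      ∀ (n α β : ℕ) (δ : ℝ), 2 ≤ α → α ≤ β → 0 < δ →
        (α : ℝ) * (β : ℝ) < (n : ℝ) ^ (1 - δ) / Real.log n →
        ∀ C : MonotoneCircuit (VertexPair n), C.Distinguishes α β →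
          (n : ℝ) ^ (c * δ ^ 2 * (α : ℝ)) ≤ (C.size : ℝ) := by
  refine ⟨1 / 16384, by norm_num, fun n α β δ hα hαβ hδ hlt C hC => ?_⟩
  obtain ⟨hn5, hL, hδ1, hmain⟩ := parameter_bounds hα hαβ hδ hlt
  obtain ⟨hC₀, hC₁⟩ := hC
  set L := Real.log n with hLdef
  set t := δ * L with ht
  have hα' : (2 : ℝ) ≤ α := by exact_mod_cast hα
  have hαβ' : (α : ℝ) ≤ β := by exact_mod_cast hαβ
  have hn5' : (5 : ℝ) ≤ n := by exact_mod_cast hn5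
  have hn0 : (0 : ℝ) < n := by linarith
  have ht0 : 0 < t := mul_pos hδ (by linarith)
  have htL : t ≤ L := mul_le_of_le_one_left (by linarith) hδ1.le
  have hexp1 : Real.exp (-t) ≤ 1 := Real.exp_le_one_iff.2 (by linarith)
  have hmain1 : (α : ℝ) * β * L < n :=
    hmain.trans_le (mul_le_of_le_one_right hn0.le hexp1)
  have hβ2 : 2 ≤ β := hα.trans hαβ
  have hαL : (3 : ℝ) ≤ α * L := by
    have := mul_le_mul hα' hL (by norm_num) (by linarith)
    linarith
  have h3β : (β : ℝ) * 3 ≤ α * β * L := by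
    have := mul_le_mul_of_nonneg_left hαL (by linarith : (0 : ℝ) ≤ β)
    linarith
  have hβn' : (β : ℝ) ≤ n := by linarith
  have hβn : β ≤ n := by exact_mod_cast hβn'
  have hαn : (α : ℝ) < n := by linarith
  have hb0 : (0 : ℝ) ≤ (β : ℝ) / n := by positivity
  have hb : (β : ℝ) / n ≤ Real.exp (-t) / 3 := by
    rw [div_le_div_iff₀ hn0 (by norm_num)]
    linarith
  have hrw : (n : ℝ) ^ (1 / 16384 * δ ^ 2 * (α : ℝ)) =
      Real.exp (t * (1 / 8192 * δ * α) / 2) := by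
    rw [Real.rpow_def_of_pos hn0, ht, ← hLdef]
    ring_nf
  rw [hrw]
  have := isProbabilityMeasure_positiveDist hβn
  have : IsProbabilityMeasure (negativeDist n α) := by unfold negativeDist; infer_instance
  have hν := positiveDist_real_isolatedClique_le hβ2 hβn
  set h := ⌊1 / 8192 * δ * α⌋₊ with hh
  have hx0 : 0 ≤ 1 / 8192 * δ * α := by positivity
  have hhle : (h : ℝ) ≤ 1 / 8192 * δ * α := Nat.floor_le hx0
  have hhlt : 1 / 8192 * δ * α < h + 1 := Nat.lt_floor_add_one _
  have hexpo : Real.exp (t * (1 / 8192 * δ * α) / 2) ≤ Real.exp (t * (h + 1) / 2) := by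
    refine Real.exp_le_exp.2 ?_
    have := mul_le_mul_of_nonneg_left hhlt.le ht0.le
    linarith
  refine hexpo.trans ?_
  rcases lt_or_ge h 2 with hlt2 | hge2
  · -- the exponent is at most `δ`, so that counting input variables is enough
    have h1 : (h : ℝ) ≤ 1 := by exact_mod_cast Nat.lt_succ_iff.1 hlt2
    have h2 := C.size_bound_of_inputs hν hC₁
    calc Real.exp (t * (h + 1) / 2) ≤ Real.exp t := by
          refine Real.exp_le_exp.2 ?_
          have := mul_le_mul_of_nonneg_left h1 ht0.le
          linarith
      _ ≤ C.size := exp_le_of_two_thirds_le ht0.le (Nat.cast_nonneg _) hb0 hb h2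
  · have hge2' : (2 : ℝ) ≤ h := by exact_mod_cast hge2
    have hhL : 2 * (3 / 2) ≤ h * L := mul_le_mul hge2' hL (by norm_num) (by linarith)
    set N := ⌈3 * ((2 * h : ℕ) : ℝ) * L⌉₊ with hNdef
    set j := ⌈2 * L⌉₊ with hjdef
    have hNge : 3 * ((2 * h : ℕ) : ℝ) * L ≤ N := Nat.le_ceil _
    have hNle : (N : ℝ) ≤ 8 * h * L := by
      have h1 : (N : ℝ) < 3 * ((2 * h : ℕ) : ℝ) * L + 1 := Nat.ceil_lt_add_one (by positivity)
      push_cast at h1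
      linarith
    have hjge : 2 * L ≤ j := Nat.le_ceil _
    have hjle : (j : ℝ) ≤ 3 * L := by
      have h1 : (j : ℝ) < 2 * L + 1 := Nat.ceil_lt_add_one (by linarith)
      linarith
    have hN0 : 0 < N := Nat.ceil_pos.2 (by positivity)
    have hj0 : 0 < j := Nat.ceil_pos.2 (by linarith)
    have hℓ : 2 * h < 2 ^ j := by
      have h1 : ((2 * h : ℕ) : ℝ) < n := by
        push_cast
        have : δ * α ≤ 1 * α := mul_le_mul_of_nonneg_right hδ1.le (by linarith)
        linarith
      have h2 : (n : ℝ) ≤ 2 ^ j := by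
        calc (n : ℝ) = Real.exp L := (Real.exp_log hn0).symm
          _ ≤ Real.exp (j * Real.log 2) := by
              refine Real.exp_le_exp.2 ?_
              have h3 : 1 / 2 ≤ Real.log 2 := by have := Real.log_two_gt_d9; linarith
              have h4 := mul_le_mul hjge h3 (by norm_num) (by linarith)
              linarith
          _ = 2 ^ j := by rw [Real.exp_nat_mul, Real.exp_log (by norm_num)]
      exact_mod_cast h1.trans_le h2
    have hp0 : 0 < (edgeProb n α : ℝ) := by
      rw [coe_edgeProb (by omega) hα]
      exact Real.rpow_pos_of_pos hn0 _
    set r := 16 * N * j / (edgeProb n α : ℝ) ^ (2 * h) with hr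
    have hr0 : 0 ≤ r := by positivity
    have hrb : r * ((β : ℝ) / n) ≤ 1 / 4 * Real.exp (-t / 2) :=
      spreadness_mul_ratio_le (by omega) hα hδ (by linarith) hmain hhle hNle hjle
    have hexp2 : Real.exp (-t / 2) ≤ 1 := Real.exp_le_one_iff.2 (by linarith)
    have hrb0 : 0 ≤ r * ((β : ℝ) / n) := mul_nonneg hr0 hb0
    rcases C.size_bound_of_sunflowers (ε := (1 / 3) ^ N) (by positivity) hge2
      (hasCliqueSunflowers_negativeDist hp0 hN0 hj0 hℓ) hr0 hb0 (by linarith) (by linarith) hν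
      (positiveDist_real_not_isolatedClique n β) hC₀ hC₁ with hA | hB
    · have h1 := card_mul_pow_le (ℓ := 2 * h) (by omega : 2 ≤ n) hNge
      have h2 := hA.trans (mul_le_mul_of_nonneg_left h1 (Nat.cast_nonneg _))
      refine exp_le_of_negative_errors htL hL hge2' ?_
      rw [hLdef]
      exact_mod_cast h2
    · exact exp_le_of_positive_errors hge2 (Nat.cast_nonneg _) hrb0 hrb hB
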